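/- Notation. For a convex set $\mathcal K\subset\mathbb R^n$ that is bounded with nonempty interior, a lattice $L\subset\mathbb R^n$ and $x\in\mathbb R^n$, put $N(L,\mathcal K,x)=|L\cap(\mathcal K+x)|$, and define the covering smoothness $$\eta(\mathcal K,L)=\sup_{x\in\mathbb R^n}\left|\frac{N(L,\mathcal K,x)}{\mathrm{vol}(\mathcal K)/\mathrm{covol}(L)}-1\right|.$$ For a prime $p$ and $1\le r\le n$, let $\pi_p:\mathbb Z^n\to\mathbb F_p^n$ be coordinatewise reduction mod $p$. The random $(p,r)$ construction A ensemble is the law of the lattice $L=\frac1p\,\pi_p^{-1}(S)$, where $S$ is uniformly distributed on the set of $r$-dimensional linear subspaces of $\mathbb F_p^n$. Let $\mathcal B_n=\{x\in\mathbb R^n:\|x\|_2\le 1\}$, and let $\log$ denote the natural logarithm. Statement. Let $n>25$ be an integer, let $\delta,\varepsilon\in(0,1)$ and $\alpha>0$, and assume $$\mathrm{vol}(\alpha\mathcal B_n)\ \ge\ e\cdot 2^{33}\left(\frac1{\varepsilon\delta}\right)^{6}n^{6}.$$ Let $p$ be a prime number satisfying $$\frac{1024}{(\varepsilon\delta)^2}\,n^2\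 \le\ p\ \le\ \frac{2048}{(\varepsilon\delta)^2}\,n^2,$$ and let $$r=3+\left\lceil\frac{n}{\log p}\cdot\frac12\log(9n)\right\rceil .$$ Then the random $(p,r)$ construction A ensemble is well defined (there are $r$-dimensional subspaces of $\mathbb F_p^n$), every lattice $L$ in it satisfies $\mathrm{covol}(p^{r/n}L)=1$, and if $L$ is drawn from it, then $$\Pr\left(\eta(\alpha\mathcal B_n,\,p^{r/n}L)\ \ge\ \varepsilon\right)<\delta .$$ -/

import Mathlib

open scoped Pointwise

noncomputable section

namespace SmoothCover

/-- `n`-dimensional Euclidean space. -/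
abbrev Euc (n : ℕ) : Type := EuclideanSpace ℝ (Fin n)

/-- `N(L, K, x) = |L ∩ (K + x)|`. For a lattice `L` and a bounded set `K` the set that is counted
is finite. -/
def pointCount {n : ℕ} (L : Submodule ℤ (Euc n)) (K : Set (Euc n)) (x : Euc n) : ℕ :=
  ((L : Set (Euc n)) ∩ (K + {x})).ncard

/-- The covering smoothness
`η(K, L) = sup_x |N(L, K, x) / (vol K / covol L) - 1|`.
The supremum is taken in `[0, ∞]`, so that it is a genuine supremum without any boundedness
assumption. -/
def coveringSmoothness {n : ℕ} (K : Set (Euc n)) (L : Submodule ℤ (Euc n)) : ENNReal :=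
  ⨆ x : Euc n, ENNReal.ofReal
    |(pointCount L K x : ℝ) / (MeasureTheory.volume.real K / ZLattice.covolume L) - 1|

/-- The `r`-dimensional linear subspaces of `𝔽_p ^ n`. -/
def grassmannian (n r p : ℕ) : Set (Submodule (ZMod p) (Fin n → ZMod p)) :=
  {S | Module.finrank (ZMod p) S = r}

/-- The preimage `π_p⁻¹(S) ⊆ ℤ ^ n ⊆ ℝ ^ n` of `S ⊆ 𝔽_p ^ n` under coordinatewise reduction
modulo `p`, as a `ℤ`-submodule of `ℝ ^ n`. -/
def reductionPreimage {n : ℕ} (p : ℕ) (S : Submodule (ZMod p) (Fin n → ZMod p)) :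
    Submodule ℤ (Euc n) where
  carrier := {x | ∃ z : Fin n → ℤ, (fun i => (z i : ZMod p)) ∈ S ∧
    x = WithLp.toLp 2 (fun i => (z i : ℝ))}
  zero_mem' := by
    refine ⟨0, ?_, by ext i; simp⟩
    have h := S.zero_mem
    convert h using 1
    ext i
    simp
  add_mem' := by
    rintro _ _ ⟨z, hz, rfl⟩ ⟨w, hw, rfl⟩
    refine ⟨z + w, ?_, by ext i; simp⟩
    have h := S.add_mem hz hw
    convert h using 1
    ext i
    simp
  smul_mem' := by
    rintro c _ ⟨z, hz, rfl⟩
    refine ⟨c • z, ?_, by ext i; simp⟩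
    have h := S.smul_mem (c : ZMod p) hz
    convert h using 1
    ext i
    simp

/-- The construction A lattice `(1/p) · π_p⁻¹(S)`. -/
def constructionA {n : ℕ} (p : ℕ) (S : Submodule (ZMod p) (Fin n → ZMod p)) :
    Submodule ℤ (Euc n) :=
  (1 / (p : ℝ)) • reductionPreimage p S

/-- Subspaces of `𝔽_p ^ n` carry the discrete sigma-algebra. -/
instance instMeasurableSpaceSubspace (n p : ℕ) :
    MeasurableSpace (Submodule (ZMod p) (Fin n → ZMod p)) := ⊤

/-- Every set of `ℤ`-submodules of `ℝ ^ n` is an event; the laws considered here are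
finitely supported. -/
instance instMeasurableSpaceLattice (n : ℕ) : MeasurableSpace (Submodule ℤ (Euc n)) := ⊤

/-- The random `(p, r)` construction A ensemble: the law of `L = (1/p) · π_p⁻¹(S)` for `S`
uniformly distributed on the `r`-dimensional subspaces of `𝔽_p ^ n`. -/
def constructionAEnsemble (n p r : ℕ) : MeasureTheory.Measure (Submodule ℤ (Euc n)) :=
  (ProbabilityTheory.uniformOn (grassmannian n r p)).map (constructionA p)

end SmoothCover

end

/-! Put `ρ = α p / p^(r/n)`. After scaling, the points to count are the integer points of a ball of
radius `ρ` whose residues lie in `S`. Rounding the centre to an integer vector changes the radius by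
at most `√n / 2` and turns the translation into a coset of `S`. Since `ρ ≥ 8 n √n / ε`
(`radius_lower_bound`), this changes the volume only by a factor `1 + O(ε)`. It remains to show
that, for the two radii `ρ ± √n / 2`, all cosets of a random `S` carry nearly their share of the
weight that counts integer points of the centred ball by residue (`ncard_deviating_submodules_le`).

The difficulty is uniformity over all cosets, which a second moment alone does not give. Choose a
random `T ⊂ S` of codimension two in `S`. The cosets of `T` form a space `Z` of dimension `N`, and
the cosets of `S` are the parallel planes of `Z` in the direction `S / T`. By the second moment
(`sum_sq_fiber_sub_mean_le`), for most `T` fewer than half of the cosets of `T` deviate. By the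
second moment again, inside one deviating coset of `S`, for at least half of the choices of `T`
almost all cosets of `T` in it deviate (`card_le_two_mul_card_concentrated`). So the set of
deviating points of `Z` nearly contains a plane whose direction is random given that set.

A Kakeya-type theorem excludes this (`card_rich_pairs_le`): a set of density below one half nearly
contains planes in only a fraction `O(N² / q)` of the directions. Its proof is the method of
multiplicities. A polynomial of degree at most `d` vanishing to order `m` on the set must vanish
identically on every such plane, so its top homogeneous part vanishes at the direction, read as a
point over the quadratic extension. Schwartz–Zippel over that extension bounds the number of such
directions. -/

section PolynomialMethod

/-! ### Polynomials with prescribed multiplicities. -/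

open Polynomial in
/-- Collecting one coefficient of the inner variable commutes with the Taylor shift of the
outer variable. -/
theorem exists_polynomial_taylor_coeff {F : Type*} [Field F] (Q : F[X][X]) (k : ℕ) :
    ∃ R : F[X], (∀ i, R.coeff i = (Q.coeff i).coeff k) ∧ R.natDegree ≤ Q.natDegree ∧
      ∀ s i, (taylor s R).coeff i = ((taylor (C s) Q).coeff i).coeff k := by
  have hR : ∀ i, (∑ j ∈ Finset.range (Q.natDegree + 1), monomial j ((Q.coeff j).coeff k)).coeff i
      = (Q.coeff i).coeff k := by
    intro i
    rw [finsetSum_coeff]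
    simp only [coeff_monomial]
    rw [Finset.sum_ite_eq']
    split_ifs with h
    · rfl
    · have hi : Q.natDegree < i := by simpa using h
      rw [coeff_eq_zero_of_natDegree_lt hi, coeff_zero]
  refine ⟨∑ j ∈ Finset.range (Q.natDegree + 1), monomial j ((Q.coeff j).coeff k), hR, ?_, ?_⟩
  · refine natDegree_sum_le_of_forall_le _ _ fun j hj => (natDegree_monomial_le _).trans ?_
    have := Finset.mem_range.1 hj; omega
  · intro s i
    have h1 : taylor (C s) Q = ∑ j ∈ Finset.range (Q.natDegree + 1),
        taylor (C s) (monomial j (Q.coeff j)) := by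
      conv_lhs => rw [Q.as_sum_range]
      rw [map_sum]
    rw [h1, map_sum, finsetSum_coeff, finsetSum_coeff, finsetSum_coeff]
    refine Finset.sum_congr rfl fun j _ => ?_
    rw [taylor_monomial, taylor_monomial, coeff_C_mul, coeff_C_mul, coeff_X_add_C_pow,
      coeff_X_add_C_pow, ← C_pow, ← C_eq_natCast, ← C_mul, coeff_mul_C]

open Polynomial in
theorem sum_rootMultiplicity_le_natDegree {F : Type*} [Field F] [Fintype F] (p : F[X]) :
    ∑ a : F, p.rootMultiplicity a ≤ p.natDegree := by
  classical
  calc ∑ a : F, p.rootMultiplicity a = ∑ a : F, p.roots.count a := by simp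
    _ = Multiset.card p.roots := Multiset.sum_count_eq_card (by simp)
    _ ≤ _ := p.card_roots'

open Polynomial in
theorem le_rootMultiplicity_of_taylor_coeff {F : Type*} [Field F] {p : F[X]} (hp : p ≠ 0)
    (a : F) (m : ℕ) (h : ∀ i < m, (taylor a p).coeff i = 0) : m ≤ p.rootMultiplicity a := by
  rw [rootMultiplicity_eq_natTrailingDegree, ← taylor_apply]
  exact le_natTrailingDegree (by simpa using hp) h

open Polynomial in
/-- The Schwartz–Zippel lemma with multiplicities, in two variables. -/
theorem card_mul_le_of_bivariate_multiplicity {F : Type*} [Field F] [Fintype F] (Q : F[X][X])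
    (hQ : Q ≠ 0) (d m : ℕ) (hd : ∀ e, Q.coeff e ≠ 0 → (Q.coeff e).natDegree + e ≤ d)
    (G : Finset (F × F))
    (hG : ∀ x ∈ G, ∀ i j, i + j < m →
      ((taylor (C x.1) (Q.map (taylorAlgHom x.2 : F[X] →+* F[X]))).coeff i).coeff j = 0) :
    G.card * m ≤ d * Fintype.card F := by
  classical
  set e := Q.natDegree with he
  set ce := Q.leadingCoeff with hce
  have hce0 : ce ≠ 0 := leadingCoeff_ne_zero.2 hQ
  have hde : ce.natDegree + e ≤ d := hd e hce0
  -- Slice by the inner variable. Where `ce` vanishes to order `k` at `c`, the `k`-th inner Taylor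
  -- coefficient is still a nonzero polynomial of degree at most `e` in the outer variable, and it
  -- keeps `m - k` orders of vanishing. The lost `k` orders are paid for by the at most `q` points
  -- of the slice, and their sum over `c` is at most the degree of `ce`.
  have key : ∀ c : F, (G.filter fun x => x.2 = c).card * m ≤
      e + Fintype.card F * ce.rootMultiplicity c := by
    intro c
    set k := ce.rootMultiplicity c with hk
    set Q' := Q.map (taylorAlgHom c : F[X] →+* F[X]) with hQ'
    obtain ⟨R, hR1, hR2, hR3⟩ := exists_polynomial_taylor_coeff Q' k
    have hRe : R.coeff e ≠ 0 := by
      rw [hR1, hQ', coeff_map]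
      have : (taylor c ce).coeff k ≠ 0 := by
        rw [hk, rootMultiplicity_eq_natTrailingDegree, ← taylor_apply]
        exact trailingCoeff_nonzero_iff_nonzero.2 (by simpa using hce0)
      exact this
    have hR0 : R ≠ 0 := fun h => hRe (by simp [h])
    have hRd : R.natDegree ≤ e := hR2.trans natDegree_map_le
    have h1 : (G.filter fun x => x.2 = c).card * (m - k) ≤ e := by
      set G' := (G.filter fun x => x.2 = c).image Prod.fst with hG'
      have hcard : G'.card = (G.filter fun x => x.2 = c).card := by
        apply Finset.card_image_of_injOn
        intro x hx y hy hxy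
        simp only [Finset.coe_filter, Set.mem_ofPred_eq] at hx hy
        exact Prod.ext hxy (hx.2.trans hy.2.symm)
      rw [← hcard]
      calc G'.card * (m - k) = ∑ s ∈ G', (m - k) := by simp
        _ ≤ ∑ s ∈ G', R.rootMultiplicity s := by
          refine Finset.sum_le_sum fun s hs => ?_
          obtain ⟨x, hx, rfl⟩ := Finset.mem_image.1 hs
          rw [Finset.mem_filter] at hx
          refine le_rootMultiplicity_of_taylor_coeff hR0 _ _ fun i hi => ?_
          rw [hR3]
          have := hG x hx.1 i k (by omega)
          rw [hx.2] at this
          exact this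
        _ ≤ ∑ s, R.rootMultiplicity s := Finset.sum_le_univ_sum_of_nonneg fun _ => Nat.zero_le _
        _ ≤ _ := (sum_rootMultiplicity_le_natDegree R).trans hRd
    have h2 : (G.filter fun x => x.2 = c).card ≤ Fintype.card F := by
      calc (G.filter fun x => x.2 = c).card
          ≤ (Finset.univ.image fun s : F => (s, c)).card := by
            refine Finset.card_le_card fun x hx => ?_
            rw [Finset.mem_filter] at hx
            exact Finset.mem_image.2 ⟨x.1, Finset.mem_univ _, by rw [← hx.2]⟩
        _ ≤ _ := Finset.card_image_le
    calc (G.filter fun x => x.2 = c).card * m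
        ≤ (G.filter fun x => x.2 = c).card * ((m - k) + k) := Nat.mul_le_mul_left _ (by omega)
      _ ≤ _ := by rw [mul_add]; exact add_le_add h1 (Nat.mul_le_mul_right _ h2)
  calc G.card * m = ∑ c : F, (G.filter fun x => x.2 = c).card * m := by
        rw [← Finset.sum_mul, Finset.card_eq_sum_card_fiberwise (f := Prod.snd) (t := Finset.univ)]
        simp
    _ ≤ ∑ c : F, (e + Fintype.card F * ce.rootMultiplicity c) := Finset.sum_le_sum fun c _ => key c
    _ = Fintype.card F * e + Fintype.card F * ∑ c : F, ce.rootMultiplicity c := by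
        rw [Finset.sum_add_distrib, ← Finset.mul_sum]; simp
    _ ≤ Fintype.card F * e + Fintype.card F * ce.natDegree :=
        Nat.add_le_add_left (Nat.mul_le_mul_left _ (sum_rootMultiplicity_le_natDegree ce)) _
    _ ≤ d * Fintype.card F := by
        rw [← mul_add, mul_comm]; exact Nat.mul_le_mul_right _ (by omega)

/-- The exponents of the monomials in `N` variables of degree less than `m`. -/
def exponentsLT (N m : ℕ) : Finset (Fin N →₀ ℕ) :=
  (Finset.range m).biUnion fun k => Finset.finsuppAntidiag Finset.univ k

theorem mem_exponentsLT {N m : ℕ} {s : Fin N →₀ ℕ} : s ∈ exponentsLT N m ↔ s.degree < m := by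
  simp [exponentsLT, Finset.mem_finsuppAntidiag, Finsupp.degree_eq_sum]

theorem card_exponentsLT_mul_factorial (N m : ℕ) :
    (exponentsLT N (m + 1)).card * N.factorial = (m + 1).ascFactorial N := by
  have h : (exponentsLT N (m + 1)).card = (m + N).choose N := by
    rw [exponentsLT, Finset.card_biUnion]
    · simp only [Finset.card_finsuppAntidiag_nat_eq_multichoose, Finset.card_univ,
        Fintype.card_fin]
      exact Nat.sum_range_multichoose m N
    · intro i _ j _ hij
      rw [Function.onFun, Finset.disjoint_left]
      intro s hs hs'
      rw [Finset.mem_finsuppAntidiag] at hs hs'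
      exact hij (hs.1.symm.trans hs'.1)
  rw [h, Nat.ascFactorial_eq_factorial_mul_choose, mul_comm]

/-- The polynomial whose variables are translated by `b`. -/
noncomputable def MvPolynomial.recenter {N : ℕ} {F : Type*} [Field F] (b : Fin N → F) :
    MvPolynomial (Fin N) F →ₐ[F] MvPolynomial (Fin N) F :=
  MvPolynomial.aeval fun i => MvPolynomial.X i + MvPolynomial.C (b i)

open MvPolynomial in
/-- A nonzero polynomial of low degree that vanishes to high order on a small set. -/
theorem exists_mvPolynomial_vanishing {N : ℕ} {F : Type*} [Field F] (B : Finset (Fin N → F))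
    (d m : ℕ) (h : B.card * (m + N) ^ N < (d + 1) ^ N) :
    ∃ P : MvPolynomial (Fin N) F, P ≠ 0 ∧ P.totalDegree ≤ d ∧
      ∀ b ∈ B, ∀ s : Fin N →₀ ℕ, s.degree < m → coeff s (recenter b P) = 0 := by
  classical
  -- Fewer linear conditions than coefficients. Multiplied by `N!`, both counts become rising
  -- factorials, which compare with the plain powers in the hypothesis.
  have hcard : B.card * (exponentsLT N m).card < (exponentsLT N (d + 1)).card := by
    refine Nat.lt_of_mul_lt_mul_right (a := N.factorial) ?_
    rw [card_exponentsLT_mul_factorial, mul_assoc]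
    refine lt_of_le_of_lt (Nat.mul_le_mul_left _ ?_)
      (h.trans_le (Nat.pow_succ_le_ascFactorial (d + 1) N))
    cases m with
    | zero => simp [exponentsLT]
    | succ m =>
      rw [card_exponentsLT_mul_factorial]
      exact (Nat.ascFactorial_le_pow_add m N).trans (Nat.pow_le_pow_left (by omega) _)
  let toPoly : (exponentsLT N (d + 1) → F) →ₗ[F] MvPolynomial (Fin N) F :=
    ∑ s, (monomial s.1).comp (LinearMap.proj s)
  have htoPoly : ∀ c, toPoly c = ∑ s, monomial s.1 (c s) := by
    intro c; simp [toPoly]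
  let Φ : (exponentsLT N (d + 1) → F) →ₗ[F] (B × exponentsLT N m → F) :=
    LinearMap.pi fun x => (lcoeff F x.2.1).comp ((recenter x.1.1).toLinearMap.comp toPoly)
  have hΦ : LinearMap.ker Φ ≠ ⊥ := by
    apply LinearMap.ker_ne_bot_of_finrank_lt
    simpa using hcard
  obtain ⟨c, hc, hc0⟩ := Submodule.exists_mem_ne_zero_of_ne_bot hΦ
  refine ⟨toPoly c, ?_, ?_, ?_⟩
  · intro h0
    apply hc0
    ext s
    have := congrArg (coeff s.1) h0
    rw [htoPoly, coeff_sum] at this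
    simp only [coeff_monomial, coeff_zero] at this
    rw [Finset.sum_eq_single s] at this
    · simpa using this
    · intro t _ hts
      rw [if_neg (fun h => hts (Subtype.ext h))]
    · simp
  · rw [htoPoly]
    refine totalDegree_finsetSum_le fun s _ => (totalDegree_monomial_le _ _).trans ?_
    have := mem_exponentsLT.1 s.2
    rw [Finsupp.degree] at this
    rw [Finsupp.sum]
    exact Nat.le_of_lt_succ this
  · intro b hb s hs
    have := congrFun (LinearMap.mem_ker.1 hc) (⟨b, hb⟩, ⟨s, mem_exponentsLT.2 hs⟩)
    simpa [Φ] using this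

end PolynomialMethod

/-! ### Restriction to planes and the Kakeya bound. -/

section Kakeya

open Polynomial

/-- Bivariate polynomials all of whose terms have total degree at least `m`. -/
noncomputable def bivariateOrderGE (F : Type*) [Field F] (m : ℕ) : Submodule F F[X][X] where
  carrier := {f | ∀ i j, i + j < m → (f.coeff i).coeff j = 0}
  zero_mem' := by simp
  add_mem' := by
    intro f g hf hg i j hij
    simp [hf i j hij, hg i j hij]
  smul_mem' := by
    intro c f hf i j hij
    simp [hf i j hij]

/-- Bivariate polynomials of total degree at most `d`. -/
noncomputable def bivariateDegreeLE (F : Type*) [Field F] (d : ℕ) : Submodule F F[X][X] where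
  carrier := {f | ∀ i j, d < i + j → (f.coeff i).coeff j = 0}
  zero_mem' := by simp
  add_mem' := by
    intro f g hf hg i j hij
    simp [hf i j hij, hg i j hij]
  smul_mem' := by
    intro c f hf i j hij
    simp [hf i j hij]

theorem coeff_coeff_mul {F : Type*} [Field F] (f g : F[X][X]) (i j : ℕ) :
    ((f * g).coeff i).coeff j = ∑ x ∈ Finset.HasAntidiagonal.antidiagonal i, ∑ y ∈ Finset.HasAntidiagonal.antidiagonal j,
      (f.coeff x.1).coeff y.1 * (g.coeff x.2).coeff y.2 := by
  simp [coeff_mul, finsetSum_coeff]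

instance bivariateOrderGE_gradedMonoid (F : Type*) [Field F] :
    SetLike.GradedMonoid (bivariateOrderGE F) where
  one_mem := fun i j hij => absurd hij (by omega)
  mul_mem := by
    intro a b f g hf hg i j hij
    rw [coeff_coeff_mul]
    refine Finset.sum_eq_zero fun x hx => Finset.sum_eq_zero fun y hy => ?_
    rw [Finset.HasAntidiagonal.mem_antidiagonal] at hx hy
    by_cases h : x.1 + y.1 < a
    · rw [hf _ _ h, zero_mul]
    · rw [hg _ _ (by omega), mul_zero]

instance bivariateDegreeLE_gradedMonoid (F : Type*) [Field F] :
    SetLike.GradedMonoid (bivariateDegreeLE F) where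
  one_mem := by
    intro i j hij
    rw [coeff_one]
    split_ifs with h
    · rw [coeff_one, if_neg (by omega)]
    · simp
  mul_mem := by
    intro a b f g hf hg i j hij
    rw [coeff_coeff_mul]
    refine Finset.sum_eq_zero fun x hx => Finset.sum_eq_zero fun y hy => ?_
    rw [Finset.HasAntidiagonal.mem_antidiagonal] at hx hy
    by_cases h : a < x.1 + y.1
    · rw [hf _ _ h, zero_mul]
    · rw [hg _ _ (by omega), mul_zero]

theorem prod_pow_mem_of_graded {F A : Type*} [Field F] [CommRing A] [Algebra F A]
    (V : ℕ → Submodule F A) [SetLike.GradedMonoid V] {N : ℕ} (g : Fin N → A)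
    (hg : ∀ i, g i ∈ V 1) (s : Fin N →₀ ℕ) : ∏ i, g i ^ s i ∈ V s.degree := by
  rw [Finsupp.degree_eq_sum]
  refine SetLike.prod_mem_graded _ _ _ fun i _ => ?_
  simpa using SetLike.pow_mem_graded (s i) (hg i)

theorem aeval_eq_sum_prod {F A : Type*} [Field F] [CommRing A] [Algebra F A] {N : ℕ}
    (g : Fin N → A) (P : MvPolynomial (Fin N) F) :
    MvPolynomial.aeval g P = ∑ s ∈ P.support, P.coeff s • ∏ i, g i ^ s i := by
  rw [MvPolynomial.aeval_def, MvPolynomial.eval₂_eq']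
  exact Finset.sum_congr rfl fun s _ => by rw [Algebra.smul_def]

/-- The linear forms parametrizing a plane through the origin. -/
noncomputable def planeDirection {F : Type*} [Field F] {N : ℕ} (b₁ b₂ : Fin N → F) (i : Fin N) :
    F[X][X] :=
  X * C (C (b₁ i)) + C X * C (C (b₂ i))

/-- The affine functions parametrizing a plane. -/
noncomputable def planePoint {F : Type*} [Field F] {N : ℕ} (a b₁ b₂ : Fin N → F) (i : Fin N) :
    F[X][X] :=
  C (C (a i)) + planeDirection b₁ b₂ i

theorem coeff_planeDirection {F : Type*} [Field F] {N : ℕ} (b₁ b₂ : Fin N → F) (k : Fin N)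
    (i j : ℕ) : ((planeDirection b₁ b₂ k).coeff i).coeff j =
      (if i = 1 ∧ j = 0 then b₁ k else 0) + if i = 0 ∧ j = 1 then b₂ k else 0 := by
  rw [planeDirection, coeff_add, coeff_add, mul_comm X, coeff_C_mul, coeff_X, ← C_mul, coeff_C,
    coeff_C_mul]
  congr 1
  · by_cases h : 1 = i
    · subst h; simp [coeff_one]
    · rw [if_neg h, if_neg (by tauto)]; simp
  · by_cases h : i = 0
    · subst h
      simp only [if_true, true_and, mul_comm X, coeff_C_mul, coeff_X]
      by_cases h : j = 1 <;> simp [h, eq_comm]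
    · simp [h]

theorem planeDirection_mem_orderGE {F : Type*} [Field F] {N : ℕ} (b₁ b₂ : Fin N → F) (k : Fin N) :
    planeDirection b₁ b₂ k ∈ bivariateOrderGE F 1 := by
  intro i j hij
  rw [coeff_planeDirection, if_neg (by omega), if_neg (by omega), add_zero]

theorem planePoint_mem_degreeLE {F : Type*} [Field F] {N : ℕ} (a b₁ b₂ : Fin N → F) (k : Fin N) :
    planePoint a b₁ b₂ k ∈ bivariateDegreeLE F 1 := by
  intro i j hij
  rw [planePoint, coeff_add, coeff_add, coeff_planeDirection, if_neg (by omega),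
    if_neg (by omega), add_zero, add_zero, coeff_C]
  split_ifs with h
  · rw [coeff_C, if_neg (by omega)]
  · simp

/-- The substituted forms have no constant term, so substitution cannot lower the order of
vanishing. -/
theorem aeval_planeDirection_mem_orderGE {F : Type*} [Field F] {N : ℕ} (b₁ b₂ : Fin N → F)
    {m : ℕ} {P : MvPolynomial (Fin N) F} (hP : ∀ s : Fin N →₀ ℕ, s.degree < m → P.coeff s = 0) :
    MvPolynomial.aeval (planeDirection b₁ b₂) P ∈ bivariateOrderGE F m := by
  rw [aeval_eq_sum_prod]
  refine Submodule.sum_mem _ fun s hs => Submodule.smul_mem _ _ ?_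
  intro i j hij
  refine prod_pow_mem_of_graded (bivariateOrderGE F) _ (planeDirection_mem_orderGE b₁ b₂) s i j ?_
  by_contra h
  exact MvPolynomial.mem_support_iff.1 hs (hP s (by omega))

theorem aeval_planePoint_mem_degreeLE {F : Type*} [Field F] {N : ℕ} (a b₁ b₂ : Fin N → F)
    (P : MvPolynomial (Fin N) F) :
    MvPolynomial.aeval (planePoint a b₁ b₂) P ∈ bivariateDegreeLE F P.totalDegree := by
  rw [aeval_eq_sum_prod]
  refine Submodule.sum_mem _ fun s hs => Submodule.smul_mem _ _ ?_
  intro i j hij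
  refine prod_pow_mem_of_graded (bivariateDegreeLE F) _ (planePoint_mem_degreeLE a b₁ b₂) s i j ?_
  have := MvPolynomial.le_totalDegree hs
  rw [Finsupp.degree]
  rw [Finsupp.sum] at this
  exact this.trans_lt hij

/-- This transfers multiplicity from `P` to its restriction to a plane: expanding the restriction at
`(s, t)` is restricting the expansion of `P` at the corresponding point. Both sides are ring
homomorphisms in `P`, so constants and variables suffice. -/
theorem taylor_aeval_planePoint {F : Type*} [Field F] {N : ℕ} (a b₁ b₂ : Fin N → F) (s t : F)
    (P : MvPolynomial (Fin N) F) :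
    taylor (C s) ((MvPolynomial.aeval (planePoint a b₁ b₂) P).map
        (taylorAlgHom t : F[X] →+* F[X])) =
      MvPolynomial.aeval (planeDirection b₁ b₂)
        (MvPolynomial.recenter (a + s • b₁ + t • b₂) P) := by
  let f : F[X][X] →+* F[X][X] := (taylorAlgHom (C s) : F[X][X] →ₐ[F[X]] F[X][X]).toRingHom.comp
    (mapRingHom (taylorAlgHom t : F[X] →+* F[X]))
  have h : f.comp (MvPolynomial.aeval (planePoint a b₁ b₂) :
      MvPolynomial (Fin N) F →ₐ[F] F[X][X]).toRingHom =
      ((MvPolynomial.aeval (planeDirection b₁ b₂)).comp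
        (MvPolynomial.recenter (a + s • b₁ + t • b₂))).toRingHom := by
    refine MvPolynomial.ringHom_ext ?_ ?_
    · intro r
      simp [f, MvPolynomial.recenter, taylor_apply]
    · intro i
      simp [f, MvPolynomial.recenter, taylor_apply, planePoint, planeDirection]
      ring
  exact RingHom.congr_fun h P

/-- The coefficient of `T ^ D` in `P (a + T x)` is the top homogeneous component of `P` at `x`. -/
theorem coeff_aeval_line {F E : Type*} [Field F] [Field E] [Algebra F E] {N : ℕ}
    (a x : Fin N → E) (P : MvPolynomial (Fin N) F) :
    (MvPolynomial.aeval (fun i => C (a i) + X * C (x i)) P : E[X]).coeff P.totalDegree =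
      MvPolynomial.aeval x (MvPolynomial.homogeneousComponent P.totalDegree P) := by
  have hlin : ∀ i, (C (a i) + X * C (x i) : E[X]).natDegree ≤ 1 := fun i => by
    compute_degree
  have hprod : ∀ (s : Fin N →₀ ℕ) (I : Finset (Fin N)),
      (∏ i ∈ I, (C (a i) + X * C (x i) : E[X]) ^ s i).natDegree ≤ ∑ i ∈ I, s i ∧
      (∏ i ∈ I, (C (a i) + X * C (x i) : E[X]) ^ s i).coeff (∑ i ∈ I, s i) =
        ∏ i ∈ I, x i ^ s i := by
    intro s I
    classical
    induction I using Finset.induction_on with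
    | empty => simp
    | insert i I hi ih =>
      rw [Finset.prod_insert hi, Finset.sum_insert hi, Finset.prod_insert hi]
      have h1 : ((C (a i) + X * C (x i) : E[X]) ^ s i).natDegree ≤ s i := by
        simpa using natDegree_pow_le_of_le (s i) (hlin i)
      refine ⟨natDegree_mul_le_of_le h1 ih.1, ?_⟩
      rw [coeff_mul_add_eq_of_natDegree_le h1 ih.1, ih.2]
      have h2 := coeff_pow_of_natDegree_le (m := s i) (hlin i)
      rw [mul_one] at h2
      rw [h2]
      simp [coeff_C]
  rw [aeval_eq_sum_prod, aeval_eq_sum_prod, finsetSum_coeff,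
    MvPolynomial.support_homogeneousComponent, Finset.sum_filter]
  refine Finset.sum_congr rfl fun s hs => ?_
  rw [coeff_smul]
  have h1 := hprod s Finset.univ
  rw [← Finsupp.degree_eq_sum] at h1
  split_ifs with h
  · rw [MvPolynomial.coeff_homogeneousComponent, if_pos h, ← h, h1.2]
  · have h3 : s.degree ≤ P.totalDegree := MvPolynomial.le_totalDegree hs
    rw [coeff_eq_zero_of_natDegree_lt (h1.1.trans_lt (lt_of_le_of_ne h3 h)), smul_zero]

/-- If `P` vanishes identically on a plane then its top homogeneous component vanishes on the
directions of the plane, over every extension. -/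
theorem aeval_top_eq_zero_of_plane {F E : Type*} [Field F] [Field E] [Algebra F E] {N : ℕ}
    (a b₁ b₂ : Fin N → F) (P : MvPolynomial (Fin N) F)
    (h : MvPolynomial.aeval (planePoint a b₁ b₂) P = 0) (β₁ β₂ : E) :
    MvPolynomial.aeval (fun i => b₁ i • β₁ + b₂ i • β₂)
      (MvPolynomial.homogeneousComponent P.totalDegree P) = 0 := by
  -- The plane parameters are specialised to `β₁ T` and `β₂ T`. This is legitimate outside `F`
  -- because `P` vanishes on the plane as a polynomial, not merely at rational points.
  let ψ : F[X][X] →+* E[X] :=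
    eval₂RingHom (aeval (C β₂ * X : E[X]) : F[X] →ₐ[F] E[X]).toRingHom (C β₁ * X)
  have hψ : ψ.comp (MvPolynomial.aeval (planePoint a b₁ b₂) :
      MvPolynomial (Fin N) F →ₐ[F] F[X][X]).toRingHom =
      (MvPolynomial.aeval (fun i => C (algebraMap F E (a i)) + X * C (b₁ i • β₁ + b₂ i • β₂)) :
        MvPolynomial (Fin N) F →ₐ[F] E[X]).toRingHom := by
    refine MvPolynomial.ringHom_ext ?_ ?_
    · intro r
      simp [ψ]
    · intro i
      simp [ψ, planePoint, planeDirection, Algebra.smul_def]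
      ring
  rw [← coeff_aeval_line (fun i => algebraMap F E (a i))]
  have := RingHom.congr_fun hψ P
  simp only [RingHom.comp_apply, AlgHom.toRingHom_eq_coe, RingHom.coe_coe, h, map_zero] at this
  rw [← this, coeff_zero]

theorem homogeneousComponent_totalDegree_ne_zero {F : Type*} [Field F] {N : ℕ}
    {P : MvPolynomial (Fin N) F} (hP : P ≠ 0) :
    MvPolynomial.homogeneousComponent P.totalDegree P ≠ 0 := by
  obtain ⟨s, hs, h⟩ := Finset.exists_mem_eq_sup P.support
    (MvPolynomial.support_nonempty.2 hP) fun s => s.sum fun _ e => e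
  intro h0
  have := congrArg (MvPolynomial.coeff s) h0
  rw [MvPolynomial.coeff_homogeneousComponent, if_pos] at this
  · exact MvPolynomial.mem_support_iff.1 hs this
  · exact h.symm

/-- A set which meets, for many directions, some plane of that direction in many points cannot be
contained in a small set. -/
theorem card_rich_directions_mul_le {F E : Type*} [Field F] [Fintype F] [Field E] [Fintype E]
    [Algebra F E] (hE : Module.finrank F E = 2) {N : ℕ} (B : Finset (Fin N → F)) (d m M : ℕ)
    (hB : B.card * (m + N) ^ N < (d + 1) ^ N) (hM : d * Fintype.card F < M * m)
    (R : Finset ((Fin N → F) × (Fin N → F)))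
    (hR : ∀ b ∈ R, ∃ a : Fin N → F, ∃ G : Finset (F × F), M ≤ G.card ∧
      ∀ x ∈ G, a + x.1 • b.1 + x.2 • b.2 ∈ B) :
    R.card * Fintype.card F ^ 2 ≤ d * Fintype.card F ^ (2 * N) := by
  classical
  obtain ⟨P, hP, hPd, hPB⟩ := exists_mvPolynomial_vanishing B d m hB
  set H := MvPolynomial.homogeneousComponent P.totalDegree P with hH
  have hcardE : Fintype.card E = Fintype.card F ^ 2 := by
    rw [Module.card_eq_pow_finrank (K := F), hE]
  have : Module.Finite F E := Module.finite_of_finrank_pos (by omega)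
  let β : Module.Basis (Fin 2) F E := Module.finBasisOfFinrankEq F E hE
  -- A pair of directions becomes one point over `E`. Schwartz–Zippel then divides by `q²` instead
  -- of `q`, so degrees well beyond `q` are useful and the multiplicity can grow with `q`.
  let φ : (Fin N → F) × (Fin N → F) → (Fin N → E) := fun b i => b.1 i • β 0 + b.2 i • β 1
  have hφ : Function.Injective φ := by
    intro b c hbc
    have key : ∀ i, b.1 i = c.1 i ∧ b.2 i = c.2 i := by
      intro i
      have h1 := congrArg β.repr (congrFun hbc i)
      have h2 := DFunLike.congr_fun h1 0
      have h3 := DFunLike.congr_fun h1 1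
      simp [φ] at h2 h3
      exact ⟨h2, h3⟩
    exact Prod.ext (funext fun i => (key i).1) (funext fun i => (key i).2)
  have hzero : ∀ b ∈ R, MvPolynomial.aeval (φ b) H = 0 := by
    intro b hb
    obtain ⟨a, G, hGM, hG⟩ := hR b hb
    refine aeval_top_eq_zero_of_plane a b.1 b.2 P ?_ (β 0) (β 1)
    -- A nonzero restriction has total degree at most `d` and multiplicity at least `m` at `M`
    -- points, contradicting `d q < M m`.
    by_contra hQ
    have h1 := card_mul_le_of_bivariate_multiplicity _ hQ d m ?_ G ?_
    · have := Nat.mul_le_mul_right m hGM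
      omega
    · intro e he
      by_contra hlt
      refine leadingCoeff_ne_zero.2 he ?_
      exact aeval_planePoint_mem_degreeLE a b.1 b.2 P e _ (by omega)
    · intro x hx i j hij
      rw [taylor_aeval_planePoint]
      exact aeval_planeDirection_mem_orderGE b.1 b.2 (hPB _ (hG x hx)) i j hij
  have hH0 : MvPolynomial.map (algebraMap F E) H ≠ 0 := by
    rw [Ne, map_eq_zero_iff _ (MvPolynomial.map_injective _ (algebraMap F E).injective)]
    exact homogeneousComponent_totalDegree_ne_zero hP
  have hsz := MvPolynomial.schwartz_zippel_totalDegree hH0 (Finset.univ : Finset E)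
  have hdeg : (MvPolynomial.map (algebraMap F E) H).totalDegree ≤ d :=
    ((MvPolynomial.homogeneousComponent_isHomogeneous _ _).map _).totalDegree_le.trans hPd
  have hcard : R.card ≤ (Finset.univ.filter fun x : Fin N → E =>
      MvPolynomial.eval x (MvPolynomial.map (algebraMap F E) H) = 0).card := by
    rw [← Finset.card_image_of_injective R hφ]
    refine Finset.card_le_card fun x hx => ?_
    obtain ⟨b, hb, rfl⟩ := Finset.mem_image.1 hx
    rw [Finset.mem_filter, MvPolynomial.eval_map, ← MvPolynomial.aeval_def]
    exact ⟨Finset.mem_univ _, hzero b hb⟩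
  rw [Fintype.piFinset_univ, Finset.card_univ, hcardE, div_le_div_iff₀ (by positivity)
    (by positivity)] at hsz
  have hsz' : (Finset.univ.filter fun x : Fin N → E =>
      MvPolynomial.eval x (MvPolynomial.map (algebraMap F E) H) = 0).card * Fintype.card F ^ 2 ≤
      (MvPolynomial.map (algebraMap F E) H).totalDegree * (Fintype.card F ^ 2) ^ N := by
    exact_mod_cast hsz
  calc R.card * Fintype.card F ^ 2 ≤ _ := Nat.mul_le_mul_right _ hcard
    _ ≤ _ := hsz'
    _ ≤ _ := by rw [← pow_mul]; exact Nat.mul_le_mul_right _ hdeg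

end Kakeya

/-! ### Second moments under random automorphisms. -/

section RandomAutomorphism

/-- Averaging a function over a finite group orbit. -/
theorem card_mul_sum_smul_eq {G β : Type*} [Group G] [Fintype G] [MulAction G β] (Ω : Finset β)
    (hΩ : ∀ (g : G), ∀ x ∈ Ω, g • x ∈ Ω) (htrans : ∀ x ∈ Ω, ∀ y ∈ Ω, ∃ g : G, g • x = y)
    (Φ : β → ℝ) {x₀ : β} (hx₀ : x₀ ∈ Ω) :
    (Ω.card : ℝ) * ∑ g : G, Φ (g • x₀) = Fintype.card G * ∑ x ∈ Ω, Φ x := by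
  have h1 : ∀ x ∈ Ω, ∑ g : G, Φ (g • x) = ∑ g : G, Φ (g • x₀) := by
    intro x hx
    obtain ⟨h, rfl⟩ := htrans x₀ hx₀ x hx
    simp only [smul_smul]
    exact Fintype.sum_equiv (Equiv.mulRight h) _ _ fun g => rfl
  calc (Ω.card : ℝ) * ∑ g : G, Φ (g • x₀) = ∑ x ∈ Ω, ∑ g : G, Φ (g • x) := by
        rw [Finset.sum_congr rfl h1]; simp
    _ = ∑ g : G, ∑ x ∈ Ω, Φ (g • x) := Finset.sum_comm
    _ = ∑ g : G, ∑ x ∈ Ω, Φ x := by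
        refine Finset.sum_congr rfl fun g _ => ?_
        refine Finset.sum_bij' (fun x _ => g • x) (fun x _ => g⁻¹ • x) ?_ ?_ ?_ ?_ ?_
        · exact fun x hx => hΩ g x hx
        · exact fun x hx => hΩ g⁻¹ x hx
        · simp
        · simp
        · simp
    _ = _ := by simp

variable {F : Type*} [Field F]

instance finite_linearEquiv {V : Type*} [AddCommGroup V] [Module F V] [Finite V] :
    Finite (V ≃ₗ[F] V) := DFunLike.finite _

noncomputable instance fintype_linearEquiv {V : Type*} [AddCommGroup V] [Module F V] [Finite V] :
    Fintype (V ≃ₗ[F] V) := Fintype.ofFinite _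

theorem exists_linearEquiv_smul_eq {V ι : Type*} [Finite ι] [AddCommGroup V] [Module F V]
    {s t : ι → V} (hs : LinearIndependent F s) (ht : LinearIndependent F t) :
    ∃ g : V ≃ₗ[F] V, g • s = t := by
  have : FiniteDimensional F (Submodule.span F (Set.range s)) :=
    FiniteDimensional.span_of_finite F (Set.finite_range s)
  obtain ⟨g, hg⟩ := Submodule.exists_linearEquiv_restrict_eq
    ((Module.Basis.span hs).equiv (Module.Basis.span ht) (Equiv.refl ι))
  refine ⟨g, funext fun i => ?_⟩
  have h1 := hg (Module.Basis.span hs i)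
  rw [Module.Basis.equiv_apply, Module.Basis.span_apply, Module.Basis.span_apply] at h1
  exact h1.symm

/-- Automorphisms act transitively on nonzero vectors, so a uniform one sends `v` to a uniform
nonzero vector. Restoring the term `Φ 0 ≥ 0` turns the identity into an inequality. -/
theorem sum_linearEquiv_apply_le {V : Type*} [AddCommGroup V] [Module F V] [Fintype V]
    (Φ : V → ℝ) (hΦ : ∀ v, 0 ≤ Φ v) {v : V} (hv : v ≠ 0) :
    ((Fintype.card V : ℝ) - 1) * ∑ g : V ≃ₗ[F] V, Φ (g v) ≤
      Fintype.card (V ≃ₗ[F] V) * ∑ u, Φ u := by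
  classical
  have h := card_mul_sum_smul_eq (G := V ≃ₗ[F] V) (Finset.univ.erase (0 : V)) ?_ ?_ Φ
    (x₀ := v) (by simpa using hv)
  · rw [Finset.card_erase_of_mem (Finset.mem_univ _), Finset.card_univ,
      Nat.cast_sub (Fintype.card_pos), Nat.cast_one] at h
    simp only [LinearEquiv.smul_def] at h
    rw [h]
    refine mul_le_mul_of_nonneg_left ?_ (by positivity)
    exact Finset.sum_le_sum_of_subset_of_nonneg (Finset.subset_univ _) fun u _ _ => hΦ u
  · intro g x hx
    simpa using hx
  · intro x hx y hy
    have hx' : x ≠ 0 := by simpa using hx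
    have hy' : y ≠ 0 := by simpa using hy
    obtain ⟨g, hg⟩ := exists_linearEquiv_smul_eq (F := F) (ι := Unit) (s := fun _ => x)
      (t := fun _ => y) (linearIndependent_unique_iff.2 hx') (linearIndependent_unique_iff.2 hy')
    exact ⟨g, congrFun hg ()⟩

/-- The second moment of the masses of the fibres of a random linear projection. -/
theorem sum_sq_fiber_sub_mean_le {X Z : Type*} [AddCommGroup X] [Module F X] [Fintype X]
    [AddCommGroup Z] [Module F Z] [Fintype Z] (w : X × Z → ℝ) (W : ℝ) (hw0 : ∀ v, 0 ≤ w v)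
    (hwW : ∀ v, w v ≤ W) :
    ∑ g : (X × Z) ≃ₗ[F] (X × Z), ∑ z, (∑ x, w (g (x, z)) - (∑ v, w v) / Fintype.card Z) ^ 2 ≤
      Fintype.card ((X × Z) ≃ₗ[F] (X × Z)) * (W * ∑ v, w v) := by
  classical
  set T := ∑ v, w v with hT
  set cG : ℝ := ((Fintype.card ((X × Z) ≃ₗ[F] (X × Z)) : ℕ) : ℝ) with hcG
  have hT0 : 0 ≤ T := Finset.sum_nonneg fun v _ => hw0 v
  have hcG0 : 0 ≤ cG := by positivity
  have hZ : (0 : ℝ) < Fintype.card Z := by exact_mod_cast Fintype.card_pos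
  have hX : (1 : ℝ) ≤ Fintype.card X := by exact_mod_cast Fintype.card_pos
  have htot : ∀ g : (X × Z) ≃ₗ[F] (X × Z), ∑ z, ∑ x, w (g (x, z)) = T := by
    intro g
    rw [Finset.sum_comm, ← Fintype.sum_prod_type']
    exact g.toEquiv.sum_comp w
  -- Two points of a common fibre differ by some `g (x', 0)`, so the second moment is a sum of pair
  -- correlations. The difference `0` is bounded through `W`, and every other difference is
  -- equidistributed over the nonzero vectors.
  have hsq : ∀ g : (X × Z) ≃ₗ[F] (X × Z), ∑ z, (∑ x, w (g (x, z))) ^ 2 =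
      ∑ x' : X, ∑ u, w u * w (u + g (x', 0)) := by
    intro g
    have h1 : ∀ z, (∑ x, w (g (x, z))) ^ 2 =
        ∑ x' : X, ∑ x, w (g (x, z)) * w (g (x, z) + g (x', 0)) := by
      intro z
      rw [sq, Finset.sum_mul_sum, Finset.sum_comm (s := Finset.univ (α := X))]
      rw [Finset.sum_comm]
      conv_rhs => rw [Finset.sum_comm]
      refine Finset.sum_congr rfl fun x _ => ?_
      symm
      refine Fintype.sum_equiv (Equiv.addLeft x) _ _ fun x' => ?_
      rw [← map_add]
      simp
    rw [Finset.sum_congr rfl fun z _ => h1 z, Finset.sum_comm]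
    refine Finset.sum_congr rfl fun x' _ => ?_
    rw [Finset.sum_comm, ← Fintype.sum_prod_type' (f := fun x z =>
      w (g (x, z)) * w (g (x, z) + g (x', 0)))]
    exact g.toEquiv.sum_comp fun u => w u * w (u + g (x', 0))
  have hterm0 : ∑ g : (X × Z) ≃ₗ[F] (X × Z), ∑ u, w u * w (u + g ((0 : X), (0 : Z))) ≤
      cG * (W * T) := by
    have : ∀ g : (X × Z) ≃ₗ[F] (X × Z), ∑ u, w u * w (u + g ((0 : X), (0 : Z))) ≤ W * T := by
      intro g
      rw [hT, Finset.mul_sum]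
      refine Finset.sum_le_sum fun u _ => ?_
      rw [show ((0 : X), (0 : Z)) = 0 from rfl, map_zero, add_zero]
      exact mul_le_mul_of_nonneg_right (hwW u) (hw0 u)
    calc _ ≤ ∑ g : (X × Z) ≃ₗ[F] (X × Z), W * T := Finset.sum_le_sum fun g _ => this g
      _ = _ := by rw [Finset.sum_const, nsmul_eq_mul, Finset.card_univ]
  have hterm : ∀ x' ∈ Finset.univ.erase (0 : X),
      ((Fintype.card X : ℝ) * Fintype.card Z - 1) *
        ∑ g : (X × Z) ≃ₗ[F] (X × Z), ∑ u, w u * w (u + g (x', 0)) ≤ cG * T ^ 2 := by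
    intro x' hx'
    have hx0 : (x', (0 : Z)) ≠ 0 := by
      intro h
      exact (Finset.mem_erase.1 hx').1 (congrArg Prod.fst h)
    rw [Finset.sum_comm, Finset.mul_sum]
    calc ∑ u, ((Fintype.card X : ℝ) * Fintype.card Z - 1) *
          ∑ g : (X × Z) ≃ₗ[F] (X × Z), w u * w (u + g (x', 0))
        ≤ ∑ u, w u * (cG * T) := by
          refine Finset.sum_le_sum fun u _ => ?_
          have h1 := sum_linearEquiv_apply_le (F := F) (fun v => w (u + v)) (fun v => hw0 _) hx0
          rw [Fintype.card_prod, Nat.cast_mul] at h1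
          have h2 : ∑ v, w (u + v) = T := Equiv.sum_comp (Equiv.addLeft u) w
          rw [h2] at h1
          rw [← Finset.mul_sum, mul_left_comm]
          exact mul_le_mul_of_nonneg_left h1 (hw0 u)
      _ = cG * T ^ 2 := by rw [← Finset.sum_mul]; ring
  have hsum : ∑ g : (X × Z) ≃ₗ[F] (X × Z), ∑ z, (∑ x, w (g (x, z))) ^ 2 ≤
      cG * (W * T) + cG * (T ^ 2 / Fintype.card Z) := by
    rw [Finset.sum_congr rfl fun g _ => hsq g, Finset.sum_comm,
      ← Finset.add_sum_erase _ _ (Finset.mem_univ (0 : X))]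
    refine add_le_add hterm0 ?_
    rcases (Finset.univ.erase (0 : X)).eq_empty_or_nonempty with he | ⟨x₁, hx₁⟩
    · rw [he, Finset.sum_empty]; positivity
    · have hX2 : (2 : ℝ) ≤ Fintype.card X := by
        have : 1 < Fintype.card X := Fintype.one_lt_card_iff.2 ⟨x₁, 0, (Finset.mem_erase.1 hx₁).1⟩
        exact_mod_cast this
      have hZ1 : (1 : ℝ) ≤ Fintype.card Z := by exact_mod_cast Fintype.card_pos
      have hpos : 0 < (Fintype.card X : ℝ) * Fintype.card Z - 1 := by nlinarith
      have hS : ∑ x' ∈ Finset.univ.erase (0 : X),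
          ∑ g : (X × Z) ≃ₗ[F] (X × Z), ∑ u, w u * w (u + g (x', 0)) ≤
          ((Fintype.card X : ℝ) - 1) *
            (cG * T ^ 2 / ((Fintype.card X : ℝ) * Fintype.card Z - 1)) := by
        refine (Finset.sum_le_card_nsmul _ _ _ fun x' hx' =>
          (le_div_iff₀' hpos).2 (hterm x' hx')).trans ?_
        rw [nsmul_eq_mul, Finset.card_erase_of_mem (Finset.mem_univ _), Finset.card_univ,
          Nat.cast_sub Fintype.card_pos, Nat.cast_one]
      refine hS.trans ?_
      -- Since `(|X| - 1) / (|X| |Z| - 1) ≤ 1 / |Z|`, the off-diagonal part is at most the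
      -- squared-mean term, which the variance subtracts. Only the diagonal survives.
      rw [← mul_div_assoc, ← mul_div_assoc, div_le_div_iff₀ hpos hZ]
      have : 0 ≤ cG * T ^ 2 := by positivity
      nlinarith
  calc ∑ g : (X × Z) ≃ₗ[F] (X × Z), ∑ z, (∑ x, w (g (x, z)) - T / Fintype.card Z) ^ 2
      = ∑ g : (X × Z) ≃ₗ[F] (X × Z), (∑ z, (∑ x, w (g (x, z))) ^ 2 - T ^ 2 / Fintype.card Z) := by
        refine Finset.sum_congr rfl fun g _ => ?_
        simp only [sub_sq]
        rw [Finset.sum_add_distrib, Finset.sum_sub_distrib, ← Finset.sum_mul, ← Finset.mul_sum,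
          htot g, Finset.sum_const, nsmul_eq_mul, Finset.card_univ]
        field_simp
        ring
    _ ≤ _ := by
        rw [Finset.sum_sub_distrib, Finset.sum_const, nsmul_eq_mul, Finset.card_univ]
        linarith

end RandomAutomorphism

/-! ### Planes almost contained in a set of density below one half. -/

section TwoSidedKakeya

/-- If a set has density below one half, then few pairs of directions span a plane some translate
of which is almost contained in the set. -/
theorem card_rich_pairs_le {F E : Type*} [Field F] [Fintype F] [Field E] [Fintype E]
    [Algebra F E] (hE : Module.finrank F E = 2) {Z : Type*} [AddCommGroup Z] [Module F Z]
    [Fintype Z] [DecidableEq Z] (B : Finset Z) (hB : 2 * B.card < Fintype.card Z) (κ θ : ℝ)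
    (hN : 1 ≤ Module.finrank F Z)
    (hκ : 4 * (Module.finrank F Z : ℝ) ^ 2 ≤ κ * Fintype.card F) (hθ0 : 0 ≤ θ)
    (hθ : 4 * Module.finrank F Z * θ ≤ 1) (R : Finset (Fin 2 → Z))
    (hR : ∀ b ∈ R, ∃ a : Z,
      ((Finset.univ.filter fun s : F × F => a + s.1 • b 0 + s.2 • b 1 ∉ B).card : ℝ) ≤
        θ * Fintype.card F ^ 2) :
    (R.card : ℝ) ≤ κ * Fintype.card Z ^ 2 := by
  classical
  set N := Module.finrank F Z with hNdef
  set q : ℝ := ((Fintype.card F : ℕ) : ℝ) with hq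
  have hq0 : 0 < q := by rw [hq]; exact_mod_cast Fintype.card_pos
  have hN1 : (1 : ℝ) ≤ N := by exact_mod_cast hN
  have hκq : 0 ≤ κ * q := le_trans (by positivity) hκ
  have hκ0 : 0 ≤ κ := nonneg_of_mul_nonneg_left hκq hq0
  have hcardZ : Fintype.card Z = Fintype.card F ^ N := Module.card_eq_pow_finrank
  -- The largest multiplicity compatible with the conclusion: the degree will be below `q m ≤ κ q²`,
  -- giving a proportion at most `κ` over the quadratic extension.
  set m : ℕ := ⌊κ * q⌋₊ with hm
  have hm1 : 4 * (N : ℝ) ^ 2 ≤ m := by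
    have : 4 * N ^ 2 ≤ m := Nat.le_floor (by push_cast; exact hκ)
    exact_mod_cast this
  have hm2 : (m : ℝ) ≤ κ * q := Nat.floor_le hκq
  have hm0 : (0 : ℝ) < m := by nlinarith
  have hθ1 : θ ≤ 1 / 4 := by nlinarith
  have hL : 0 < (1 - θ) * q * m := by
    have : 0 < 1 - θ := by linarith
    positivity
  -- `d` is the largest integer strictly below `(1 - θ) q m`. Strictness yields `d q < M m`, while
  -- `d + 1` is large enough for the dimension count.
  obtain ⟨d, hd⟩ : ∃ d, ⌈(1 - θ) * q * m⌉₊ = d + 1 :=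
    ⟨_, (Nat.succ_pred_eq_of_pos (Nat.ceil_pos.2 hL)).symm⟩
  have hd1 : (1 - θ) * q * m ≤ (d : ℝ) + 1 := by
    have := Nat.le_ceil ((1 - θ) * q * m)
    rw [hd] at this
    exact_mod_cast this
  have hd2 : (d : ℝ) < (1 - θ) * q * m := by
    have : d < ⌈(1 - θ) * q * m⌉₊ := by omega
    exact Nat.lt_ceil.1 this
  set M : ℕ := ⌈(1 - θ) * q ^ 2⌉₊ with hM
  let e : Z ≃ₗ[F] (Fin N → F) := (Module.finBasis F Z).equivFun
  -- The ratio is at least `1 - θ - N / m`. Bernoulli loses `N θ + N² / m`, at most `1/4 + 1/4`,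
  -- which matches the density one half allowed for `B`.
  have hbern : (1 : ℝ) / 2 ≤ ((d + 1) / (q * (m + N))) ^ N := by
    have h1 : 1 - (θ + N / m) ≤ (d + 1) / (q * (m + N)) := by
      rw [le_div_iff₀ (by positivity)]
      refine le_trans ?_ hd1
      have : (1 - (θ + N / m)) * (q * (m + N)) =
          (1 - θ) * q * m - q * N * (θ + N / m) := by field_simp; ring
      rw [this]
      have : 0 ≤ q * N * (θ + N / m) := by positivity
      linarith
    have h2 : N * ((N : ℝ) / m) ≤ 1 / 4 := by
      rw [← mul_div_assoc, div_le_iff₀ hm0]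
      nlinarith
    have h3 : (N : ℝ) / m ≤ 1 / 4 := le_trans (le_mul_of_one_le_left (by positivity) hN1) h2
    calc (1 : ℝ) / 2 ≤ 1 + N * (-(θ + N / m)) := by nlinarith
      _ ≤ (1 + (-(θ + N / m))) ^ N := one_add_mul_le_pow (by linarith) N
      _ ≤ _ := pow_le_pow_left₀ (by linarith) (by linarith) N
  have hcard : (B.image e).card * (m + N) ^ N < (d + 1) ^ N := by
    have h1 : 2 * ((B.image e).card : ℝ) < q ^ N := by
      rw [Finset.card_image_of_injective _ e.injective, hq]
      exact_mod_cast hcardZ ▸ hB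
    rw [div_pow, mul_pow, div_le_div_iff₀ (by norm_num) (by positivity)] at hbern
    have h2 : ((B.image e).card : ℝ) * (m + N) ^ N < (d + 1) ^ N := by
      have : (0 : ℝ) < (m + N) ^ N := by positivity
      nlinarith
    exact_mod_cast h2
  have hdM : d * Fintype.card F < M * m := by
    have : (d : ℝ) * q < M * m := by
      have h1 : (1 - θ) * q ^ 2 ≤ M := Nat.le_ceil _
      calc (d : ℝ) * q < (1 - θ) * q * m * q := mul_lt_mul_of_pos_right hd2 hq0
        _ = (1 - θ) * q ^ 2 * m := by ring
        _ ≤ M * m := mul_le_mul_of_nonneg_right h1 hm0.le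
    rw [hq] at this
    exact_mod_cast this
  let ψ : (Fin 2 → Z) → (Fin N → F) × (Fin N → F) := fun b => (e (b 0), e (b 1))
  have hψ : Function.Injective ψ := by
    intro b c hbc
    have h0 := e.injective (congrArg Prod.fst hbc)
    have h1 := e.injective (congrArg Prod.snd hbc)
    funext i
    fin_cases i
    · exact h0
    · exact h1
  have hmain := card_rich_directions_mul_le hE (B.image e) d m M hcard hdM (R.image ψ) (by
    intro c hc
    obtain ⟨b, hb, rfl⟩ := Finset.mem_image.1 hc
    obtain ⟨a, ha⟩ := hR b hb
    refine ⟨e a, Finset.univ.filter fun s : F × F => a + s.1 • b 0 + s.2 • b 1 ∈ B, ?_, ?_⟩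
    · have h1 := Finset.card_filter_add_card_filter_not (s := (Finset.univ : Finset (F × F)))
        (fun s : F × F => a + s.1 • b 0 + s.2 • b 1 ∈ B)
      rw [Finset.card_univ, Fintype.card_prod] at h1
      have h2 : ((Finset.univ.filter fun s : F × F => a + s.1 • b 0 + s.2 • b 1 ∈ B).card : ℝ) +
          ((Finset.univ.filter fun s : F × F => a + s.1 • b 0 + s.2 • b 1 ∉ B).card : ℝ) =
          q * q := by rw [hq]; exact_mod_cast h1
      refine Nat.ceil_le.2 ?_
      linarith
    · intro s hs
      refine Finset.mem_image.2 ⟨_, (Finset.mem_filter.1 hs).2, ?_⟩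
      simp [ψ])
  rw [Finset.card_image_of_injective _ hψ] at hmain
  have h1 : (R.card : ℝ) * q ^ 2 ≤ d * q ^ (2 * N) := by rw [hq]; exact_mod_cast hmain
  have h2 : (Fintype.card Z : ℝ) ^ 2 = q ^ (2 * N) := by
    rw [hcardZ, hq]; push_cast; ring
  rw [h2]
  have h3 : (d : ℝ) ≤ κ * q ^ 2 := by
    calc (d : ℝ) ≤ (1 - θ) * q * m := hd2.le
      _ ≤ 1 * q * m := by gcongr; linarith
      _ ≤ 1 * q * (κ * q) := by gcongr
      _ = κ * q ^ 2 := by ring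
  have h4 : (R.card : ℝ) * q ^ 2 ≤ (κ * q ^ (2 * N)) * q ^ 2 := by
    calc _ ≤ _ := h1
      _ ≤ κ * q ^ 2 * q ^ (2 * N) := by gcongr
      _ = _ := by ring
  exact le_of_mul_le_mul_right h4 (by positivity)

/-- For a set of density below one half, few automorphisms carry the standard plane to a direction
some translate of which is almost contained in the set. -/
theorem card_automorphisms_rich_le {F E : Type*} [Field F] [Fintype F] [Field E] [Fintype E]
    [Algebra F E] (hE : Module.finrank F E = 2) {Z : Type*} [AddCommGroup Z] [Module F Z]
    [Fintype Z] [DecidableEq Z] (B : Finset Z) (hB : 2 * B.card < Fintype.card Z) (κ θ : ℝ)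
    (hN : 2 ≤ Module.finrank F Z) (hq3 : 3 ≤ Fintype.card F)
    (hκ : 4 * (Module.finrank F Z : ℝ) ^ 2 ≤ κ * Fintype.card F) (hθ0 : 0 ≤ θ)
    (hθ : 4 * Module.finrank F Z * θ ≤ 1) {b₀ : Fin 2 → Z} (hb₀ : LinearIndependent F b₀)
    (S : Finset (Z ≃ₗ[F] Z))
    (hS : ∀ g ∈ S, ∃ a : Z,
      ((Finset.univ.filter fun s : F × F => a + s.1 • g (b₀ 0) + s.2 • g (b₀ 1) ∉ B).card : ℝ) ≤
        θ * Fintype.card F ^ 2) :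
    (S.card : ℝ) ≤ 2 * κ * Fintype.card (Z ≃ₗ[F] Z) := by
  classical
  set R : Finset (Fin 2 → Z) := Finset.univ.filter fun b => ∃ a : Z,
      ((Finset.univ.filter fun s : F × F => a + s.1 • b 0 + s.2 • b 1 ∉ B).card : ℝ) ≤
        θ * Fintype.card F ^ 2 with hRdef
  have hR : (R.card : ℝ) ≤ κ * Fintype.card Z ^ 2 :=
    card_rich_pairs_le hE B hB κ θ (by omega) hκ hθ0 hθ R fun b hb => (Finset.mem_filter.1 hb).2
  set Ω : Finset (Fin 2 → Z) := Finset.univ.filter fun b => LinearIndependent F b with hΩ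
  -- At least half of all pairs are independent because `|Z| ≥ q² ≥ 3 q`. This is the factor two
  -- lost in passing from pairs to automorphisms.
  have hΩcard : (Fintype.card Z : ℝ) ^ 2 ≤ 2 * Ω.card := by
    have h1 := card_linearIndependent (K := F) (V := Z) hN
    rw [Nat.card_eq_fintype_card, Fintype.card_subtype, Fin.prod_univ_two,
      ← Module.card_eq_pow_finrank (K := F) (V := Z)] at h1
    have h2 : Ω.card = (Fintype.card Z - 1) * (Fintype.card Z - Fintype.card F) := by
      simpa using h1
    have h3 : Fintype.card F ^ 2 ≤ Fintype.card Z := by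
      rw [Module.card_eq_pow_finrank (K := F) (V := Z)]
      exact Nat.pow_le_pow_right (by omega) hN
    have h4 : 3 * Fintype.card F ≤ Fintype.card Z := by nlinarith
    rw [h2, Nat.cast_mul, Nat.cast_sub (by omega), Nat.cast_sub (by omega), Nat.cast_one]
    have h5 : (3 : ℝ) * Fintype.card F ≤ Fintype.card Z := by exact_mod_cast h4
    have h6 : (3 : ℝ) ≤ Fintype.card F := by exact_mod_cast hq3
    nlinarith
  have havg := card_mul_sum_smul_eq (G := Z ≃ₗ[F] Z) Ω ?_ ?_
    (fun b => if b ∈ R then (1 : ℝ) else 0) (x₀ := b₀) (by simpa [hΩ] using hb₀)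
  · have hS1 : (S.card : ℝ) ≤ ∑ g : Z ≃ₗ[F] Z, if g • b₀ ∈ R then (1 : ℝ) else 0 := by
      rw [← Finset.sum_filter, Finset.sum_const, nsmul_eq_mul, mul_one]
      refine Nat.cast_le.2 (Finset.card_le_card fun g hg => ?_)
      exact Finset.mem_filter.2 ⟨Finset.mem_univ _, Finset.mem_filter.2 ⟨Finset.mem_univ _, hS g hg⟩⟩
    have hR1 : (∑ b ∈ Ω, if b ∈ R then (1 : ℝ) else 0) ≤ R.card := by
      rw [← Finset.sum_filter, Finset.sum_const, nsmul_eq_mul, mul_one]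
      exact Nat.cast_le.2 (Finset.card_le_card fun b hb => (Finset.mem_filter.1 hb).2)
    have hZ : (0 : ℝ) < Fintype.card Z := by exact_mod_cast Fintype.card_pos
    have hΩ0 : (0 : ℝ) < Ω.card := by nlinarith
    have hκ0 : 0 ≤ κ := by
      refine nonneg_of_mul_nonneg_left (le_trans (by positivity) hκ) ?_
      exact_mod_cast Fintype.card_pos
    refine le_of_mul_le_mul_left ?_ hΩ0
    calc (Ω.card : ℝ) * S.card ≤ _ := mul_le_mul_of_nonneg_left hS1 hΩ0.le
      _ = _ := havg
      _ ≤ Fintype.card (Z ≃ₗ[F] Z) * (κ * (2 * Ω.card)) := by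
        refine mul_le_mul_of_nonneg_left ?_ (by positivity)
        exact hR1.trans (hR.trans (mul_le_mul_of_nonneg_left hΩcard hκ0))
      _ = _ := by ring
  · intro g b hb
    rw [hΩ, Finset.mem_filter] at hb ⊢
    exact ⟨Finset.mem_univ _, hb.2.map' g.toLinearMap g.ker⟩
  · intro b hb c hc
    exact exists_linearEquiv_smul_eq (Finset.mem_filter.1 hb).2 (Finset.mem_filter.1 hc).2

end TwoSidedKakeya

/-! ### Equidistribution over all translates of a random subspace. -/

section RandomSubspaceSmoothness

variable {F : Type*} [Field F]

/-- Resampling: a uniform `g` stays uniform after right multiplication by any `r h`, so an event may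
be estimated over `h` with `g` frozen. -/
theorem card_mul_card_filter_eq_sum {G H : Type*} [Group G] [Fintype G] [Fintype H] (r : H → G)
    (R : G → Prop) [DecidablePred R] :
    Fintype.card H * (Finset.univ.filter R).card =
      ∑ g : G, (Finset.univ.filter fun h : H => R (g * r h)).card := by
  simp only [Finset.card_filter]
  rw [Finset.sum_comm]
  have : ∀ h : H, ∑ g : G, (if R (g * r h) then 1 else 0) = ∑ g : G, if R g then 1 else 0 :=
    fun h => Fintype.sum_equiv (Equiv.mulRight (r h)) _ _ fun g => rfl
  rw [Finset.sum_congr rfl fun h _ => this h, Finset.sum_const, Finset.card_univ, smul_eq_mul]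

/-- A random linear projection has, for most automorphisms, few fibres of deviating mass. -/
theorem card_many_deviating_fibers_le {X Z : Type*} [AddCommGroup X] [Module F X] [Fintype X]
    [AddCommGroup Z] [Module F Z] [Fintype Z] (w : X × Z → ℝ) {W ε μ : ℝ} (hw0 : ∀ v, 0 ≤ w v)
    (hwW : ∀ v, w v ≤ W) (hε : 0 < ε) (hμ : 0 < μ) (hμw : ∑ v, w v = μ * Fintype.card Z) :
    ((Finset.univ.filter fun g : (X × Z) ≃ₗ[F] (X × Z) => Fintype.card Z ≤
      2 * (Finset.univ.filter fun z => ε / 2 * μ ≤ |∑ x, w (g (x, z)) - μ|).card).card : ℝ) ≤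
      Fintype.card ((X × Z) ≃ₗ[F] (X × Z)) * (8 * W / (ε ^ 2 * μ)) := by
  have hZ : (0 : ℝ) < Fintype.card Z := by exact_mod_cast Fintype.card_pos
  have hmom := sum_sq_fiber_sub_mean_le (F := F) w W hw0 hwW
  rw [hμw, mul_div_cancel_right₀ _ hZ.ne'] at hmom
  set S := Finset.univ.filter fun g : (X × Z) ≃ₗ[F] (X × Z) => Fintype.card Z ≤
      2 * (Finset.univ.filter fun z => ε / 2 * μ ≤ |∑ x, w (g (x, z)) - μ|).card with hS
  -- Chebyshev: at least half of the fibres contribute `(ε μ / 2)²` each.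
  have hlow : ∀ g ∈ S, (Fintype.card Z : ℝ) / 2 * (ε / 2 * μ) ^ 2 ≤
      ∑ z, (∑ x, w (g (x, z)) - μ) ^ 2 := by
    intro g hg
    have h1 : (Fintype.card Z : ℝ) ≤
      2 * (Finset.univ.filter fun z => ε / 2 * μ ≤ |∑ x, w (g (x, z)) - μ|).card := by
      exact_mod_cast (Finset.mem_filter.1 hg).2
    calc (Fintype.card Z : ℝ) / 2 * (ε / 2 * μ) ^ 2
        ≤ (Finset.univ.filter fun z => ε / 2 * μ ≤ |∑ x, w (g (x, z)) - μ|).card *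
          (ε / 2 * μ) ^ 2 := by gcongr; linarith
      _ = ∑ z ∈ Finset.univ.filter fun z => ε / 2 * μ ≤ |∑ x, w (g (x, z)) - μ|,
          (ε / 2 * μ) ^ 2 := by rw [Finset.sum_const, nsmul_eq_mul]
      _ ≤ ∑ z ∈ Finset.univ.filter fun z => ε / 2 * μ ≤ |∑ x, w (g (x, z)) - μ|,
          (∑ x, w (g (x, z)) - μ) ^ 2 := by
          refine Finset.sum_le_sum fun z hz => ?_
          rw [← sq_abs (∑ x, w (g (x, z)) - μ)]
          exact pow_le_pow_left₀ (by positivity) (Finset.mem_filter.1 hz).2 2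
      _ ≤ _ := Finset.sum_le_sum_of_subset_of_nonneg (Finset.filter_subset _ _)
          fun z _ _ => sq_nonneg _
  have hsum : (S.card : ℝ) * ((Fintype.card Z : ℝ) / 2 * (ε / 2 * μ) ^ 2) ≤
      Fintype.card ((X × Z) ≃ₗ[F] (X × Z)) * (W * (μ * Fintype.card Z)) := by
    refine le_trans ?_ hmom
    rw [← nsmul_eq_mul, ← Finset.sum_const]
    refine (Finset.sum_le_sum hlow).trans ?_
    exact Finset.sum_le_sum_of_subset_of_nonneg (Finset.filter_subset _ _)
      fun g _ _ => Finset.sum_nonneg fun z _ => sq_nonneg _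
  rw [← mul_div_assoc, le_div_iff₀ (by positivity)]
  refine le_of_mul_le_mul_right (a := μ * Fintype.card Z / 8) ?_ (by positivity)
  calc _ = (S.card : ℝ) * ((Fintype.card Z : ℝ) / 2 * (ε / 2 * μ) ^ 2) := by ring
    _ ≤ _ := hsum
    _ = _ := by ring

/-- If the total mass deviates, then under most automorphisms almost all fibres deviate. -/
theorem card_le_two_mul_card_concentrated {X P : Type*} [AddCommGroup X] [Module F X] [Fintype X]
    [AddCommGroup P] [Module F P] [Fintype P] (w : X × P → ℝ) {W ε μ : ℝ} (hw0 : ∀ v, 0 ≤ w v)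
    (hwW : ∀ v, w v ≤ W) (hε : 0 < ε) (hε1 : ε ≤ 1) (hμ : 0 < μ)
    (hdev : ε * μ ≤ |(∑ v, w v) / Fintype.card P - μ|) :
    (Fintype.card ((X × P) ≃ₗ[F] (X × P)) : ℝ) ≤
      2 * (Finset.univ.filter fun h : (X × P) ≃ₗ[F] (X × P) =>
        ((Finset.univ.filter fun s => ¬ ε / 2 * μ ≤ |∑ x, w (h (x, s)) - μ|).card : ℝ) ≤
          64 * W / (ε ^ 2 * μ) * Fintype.card P).card := by
  classical
  have hP : (0 : ℝ) < Fintype.card P := by exact_mod_cast Fintype.card_pos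
  have hmom := sum_sq_fiber_sub_mean_le (F := F) w W hw0 hwW
  set A := (∑ v, w v) / Fintype.card P with hA
  have hT : ∑ v, w v = A * Fintype.card P := by rw [hA]; field_simp
  have hA0 : 0 ≤ A := div_nonneg (Finset.sum_nonneg fun v _ => hw0 v) hP.le
  have hW0 : 0 ≤ W := (hw0 0).trans (hwW 0)
  rw [hT] at hmom
  set cH : ℝ := ((Fintype.card ((X × P) ≃ₗ[F] (X × P)) : ℕ) : ℝ) with hcH
  have hcH0 : 0 ≤ cH := by positivity
  set bad : ((X × P) ≃ₗ[F] (X × P)) → Finset P := fun h =>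
    Finset.univ.filter fun s => ¬ ε / 2 * μ ≤ |∑ x, w (h (x, s)) - μ| with hbad
  -- A fibre close to `μ` is far from the true mean `A`. The gap must scale with `A + μ` because `A`
  -- has no upper bound; the factor `A` in the second moment is then absorbed by `A ≤ A + μ`.
  set τ := ε ^ 2 * μ * (A + μ) / 32 with hτ
  have hτ0 : 0 < τ := by positivity
  have hpt : ∀ h : (X × P) ≃ₗ[F] (X × P), ∀ s ∈ bad h, τ ≤ (∑ x, w (h (x, s)) - A) ^ 2 := by
    intro h s hs
    have h1 := (Finset.mem_filter.1 hs).2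
    rw [not_le] at h1
    set f := ∑ x, w (h (x, s))
    rw [abs_lt] at h1
    -- If `A` is too large, then `f ≤ (1 + ε/2) μ ≤ (1 - ε/4) A`, using `ε ≤ 1`. If it is too small,
    -- then `f - A ≥ ε μ / 2`.
    rcases le_abs.1 hdev with h2 | h2
    · have h3 : ε * A / 4 ≤ A - f := by
        have h4 : A - (1 + ε / 2) * μ ≤ A - f := by linarith
        have h5 : μ * (1 + ε) ≤ A := by linarith
        have h6 : (1 + ε / 2) * μ ≤ A * (1 - ε / 4) := by
          calc (1 + ε / 2) * μ ≤ (1 - ε / 4) * (1 + ε) * μ := by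
                apply mul_le_mul_of_nonneg_right _ hμ.le; nlinarith
            _ = (1 - ε / 4) * (μ * (1 + ε)) := by ring
            _ ≤ (1 - ε / 4) * A := mul_le_mul_of_nonneg_left h5 (by linarith)
            _ = _ := by ring
        linarith
      have h4 : (ε * A / 4) ^ 2 ≤ (A - f) ^ 2 := pow_le_pow_left₀ (by positivity) h3 2
      have h5 : μ ≤ A := by nlinarith
      have h6 : τ ≤ (ε * A / 4) ^ 2 := by
        have h7 : μ * (A + μ) ≤ 2 * A ^ 2 := by nlinarith
        have h8 := mul_le_mul_of_nonneg_left h7 (sq_nonneg ε)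
        rw [hτ]; linarith
      calc τ ≤ _ := h6
        _ ≤ _ := h4
        _ = _ := by ring
    · have h3 : ε / 2 * μ ≤ f - A := by linarith
      have h4 : (ε / 2 * μ) ^ 2 ≤ (f - A) ^ 2 := pow_le_pow_left₀ (by positivity) h3 2
      have h5 : A ≤ μ := by nlinarith
      have h7 : μ * (A + μ) ≤ 2 * μ ^ 2 := by nlinarith
      have h8 := mul_le_mul_of_nonneg_left h7 (sq_nonneg ε)
      have h9 : 0 ≤ ε ^ 2 * μ ^ 2 := by positivity
      rw [hτ]; linarith
  have hsum : (∑ h, ((bad h).card : ℝ)) * τ ≤ cH * (W * (A * Fintype.card P)) := by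
    refine le_trans ?_ hmom
    rw [Finset.sum_mul]
    refine Finset.sum_le_sum fun h _ => ?_
    rw [← nsmul_eq_mul, ← Finset.sum_const]
    refine (Finset.sum_le_sum (hpt h)).trans ?_
    exact Finset.sum_le_sum_of_subset_of_nonneg (Finset.subset_univ _) fun s _ _ => sq_nonneg _
  -- Twice the bound on the average number of non-deviating fibres, so that Markov keeps at least
  -- half of the automorphisms.
  set L := 64 * W / (ε ^ 2 * μ) * Fintype.card P with hL
  have hL0 : 0 ≤ L := by positivity
  have hsum' : 2 * ∑ h, ((bad h).card : ℝ) ≤ cH * L := by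
    refine le_of_mul_le_mul_right (a := τ) ?_ hτ0
    calc 2 * (∑ h, ((bad h).card : ℝ)) * τ = 2 * ((∑ h, ((bad h).card : ℝ)) * τ) := by ring
      _ ≤ 2 * (cH * (W * (A * Fintype.card P))) := by linarith
      _ ≤ 2 * (cH * (W * ((A + μ) * Fintype.card P))) := by gcongr; linarith
      _ = cH * L * τ := by rw [hL, hτ]; field_simp; ring
  set good := Finset.univ.filter fun h : (X × P) ≃ₗ[F] (X × P) => ((bad h).card : ℝ) ≤ L with hgood
  have hsplit : (good.card : ℝ) + ((Finset.univ.filter fun h : (X × P) ≃ₗ[F] (X × P) =>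
      ¬ ((bad h).card : ℝ) ≤ L).card : ℝ) = cH := by
    rw [hcH, ← Finset.card_univ]
    exact_mod_cast Finset.card_filter_add_card_filter_not
      (s := (Finset.univ : Finset ((X × P) ≃ₗ[F] (X × P)))) fun h => ((bad h).card : ℝ) ≤ L
  set rest := Finset.univ.filter fun h : (X × P) ≃ₗ[F] (X × P) => ¬ ((bad h).card : ℝ) ≤ L
    with hrest
  change cH ≤ 2 * good.card
  by_contra hcon
  rw [not_le] at hcon
  have hrest0 : rest.Nonempty := by
    rw [← Finset.card_pos]
    have : (0 : ℝ) < rest.card := by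
      have : (0 : ℝ) ≤ good.card := Nat.cast_nonneg _
      linarith
    exact_mod_cast this
  have hmarkov : (rest.card : ℝ) * L < ∑ h, ((bad h).card : ℝ) := by
    calc (rest.card : ℝ) * L = ∑ h ∈ rest, L := by rw [Finset.sum_const, nsmul_eq_mul]
      _ < ∑ h ∈ rest, ((bad h).card : ℝ) :=
        Finset.sum_lt_sum_of_nonempty hrest0 fun h hh => not_le.1 (Finset.mem_filter.1 hh).2
      _ ≤ _ := Finset.sum_le_sum_of_subset_of_nonneg (Finset.subset_univ _)
        fun s _ _ => Nat.cast_nonneg _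
  nlinarith

/-- A random subspace of codimension at least two equidistributes, simultaneously for all its
translates, every bounded weight of sufficiently large mass. -/
theorem card_deviating_automorphisms_le [Fintype F] {E : Type*} [Field E] [Fintype E]
    [Algebra F E] (hE : Module.finrank F E = 2) {X Y : Type*} [AddCommGroup X] [Module F X]
    [Fintype X] [AddCommGroup Y] [Module F Y] [Fintype Y] (w : X × ((F × F) × Y) → ℝ)
    {W ε κ μ : ℝ} {N : ℕ} (hw0 : ∀ v, 0 ≤ w v) (hwW : ∀ v, w v ≤ W) (hε : 0 < ε) (hε1 : ε ≤ 1)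
    (hμ : 0 < μ) (hμw : ∑ v, w v = μ * Fintype.card ((F × F) × Y))
    (hWμ : W * Fintype.card F ≤ μ) (hN : Module.finrank F ((F × F) × Y) = N)
    (hκ : 4 * (N : ℝ) ^ 2 ≤ κ * Fintype.card F) (hq : 256 * (N : ℝ) ≤ ε ^ 2 * Fintype.card F) :
    ((Finset.univ.filter fun g : (X × ((F × F) × Y)) ≃ₗ[F] (X × ((F × F) × Y)) =>
      ∃ y : Y, ε * (Fintype.card F ^ 2 * μ) ≤
        |∑ v : X × (F × F), w (g (v.1, (v.2, y))) - Fintype.card F ^ 2 * μ|).card : ℝ) ≤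
      Fintype.card ((X × ((F × F) × Y)) ≃ₗ[F] (X × ((F × F) × Y))) *
        (16 / (ε ^ 2 * Fintype.card F) + 4 * κ) := by
  classical
  set q : ℝ := ((Fintype.card F : ℕ) : ℝ) with hqdef
  have hq0 : 0 < q := by rw [hqdef]; exact_mod_cast Fintype.card_pos
  set cG : ℝ := ((Fintype.card ((X × ((F × F) × Y)) ≃ₗ[F] (X × ((F × F) × Y))) : ℕ) : ℝ) with hcG
  have hcG0 : 0 ≤ cG := by positivity
  have hN2 : 2 ≤ N := by
    rw [← hN, Module.finrank_prod, Module.finrank_prod, Module.finrank_self]; omega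
  have hN2' : (2 : ℝ) ≤ N := by exact_mod_cast hN2
  have hW0 : 0 ≤ W := (hw0 0).trans (hwW 0)
  have hκ0 : 0 ≤ κ := nonneg_of_mul_nonneg_left (le_trans (by positivity) hκ) hq0
  have hε2 : ε ^ 2 ≤ 1 := by nlinarith
  have hq3 : 3 ≤ Fintype.card F := by
    have : (3 : ℝ) ≤ q := by nlinarith
    rw [hqdef] at this
    exact_mod_cast this
  -- The exceptional proportion `64 W / (ε² μ)` after inserting `W q ≤ μ`. The hypothesis `hq` is
  -- exactly `4 N θ ≤ 1`.
  set θ := 64 / (ε ^ 2 * q) with hθ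
  have hθ0 : 0 ≤ θ := by positivity
  have hθN : 4 * N * θ ≤ 1 := by
    rw [hθ, ← mul_div_assoc, div_le_one (by positivity)]; linarith
  have hWθ : 64 * W / (ε ^ 2 * μ) ≤ θ := by
    rw [hθ, div_le_div_iff₀ (by positivity) (by positivity)]
    have : 0 ≤ ε ^ 2 := by positivity
    nlinarith [mul_le_mul_of_nonneg_left hWμ this]
  -- The label `z` runs over the cosets of the small subspace, the image of `X`. Each `y` is a coset
  -- of the large subspace, and its labels `(s, y)` form a plane.
  let dev : ((X × ((F × F) × Y)) ≃ₗ[F] (X × ((F × F) × Y))) → Finset ((F × F) × Y) := fun g =>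
    Finset.univ.filter fun z => ε / 2 * μ ≤ |∑ x, w (g (x, z)) - μ|
  let rich : ((X × ((F × F) × Y)) ≃ₗ[F] (X × ((F × F) × Y))) → Prop := fun g =>
    ∃ y : Y, ((Finset.univ.filter fun s : F × F => (s, y) ∉ dev g).card : ℝ) ≤ θ * q ^ 2
  set bad := Finset.univ.filter fun g : (X × ((F × F) × Y)) ≃ₗ[F] (X × ((F × F) × Y)) =>
      ∃ y : Y, ε * (q ^ 2 * μ) ≤
        |∑ v : X × (F × F), w (g (v.1, (v.2, y))) - q ^ 2 * μ| with hbad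
  have hcardP : (Fintype.card (F × F) : ℝ) = q ^ 2 := by
    rw [Fintype.card_prod, hqdef]; push_cast; ring
  -- deviation on a large subspace is inherited by most fibres of a random projection
  have hbad_rich : (bad.card : ℝ) ≤ 2 * (Finset.univ.filter rich).card := by
    -- Resampling by these maps fixes each coset of the large subspace and randomises only the small
    -- subspace inside it.
    let ext : ((X × (F × F)) ≃ₗ[F] (X × (F × F))) →
        ((X × ((F × F) × Y)) ≃ₗ[F] (X × ((F × F) × Y))) := fun h =>
      (LinearEquiv.prodAssoc F X (F × F) Y).symm ≪≫ₗ (h.prodCongr (LinearEquiv.refl F Y)) ≪≫ₗ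
        LinearEquiv.prodAssoc F X (F × F) Y
    have hcount := card_mul_card_filter_eq_sum ext rich
    have hH : (0 : ℝ) < Fintype.card ((X × (F × F)) ≃ₗ[F] (X × (F × F))) := by
      exact_mod_cast Fintype.card_pos
    have hcount' : (Fintype.card ((X × (F × F)) ≃ₗ[F] (X × (F × F))) : ℝ) *
        (Finset.univ.filter rich).card = ∑ g,
          ((Finset.univ.filter fun h : (X × (F × F)) ≃ₗ[F] (X × (F × F)) =>
            rich (g * ext h)).card : ℝ) := by exact_mod_cast hcount
    have hg : ∀ g ∈ bad, (Fintype.card ((X × (F × F)) ≃ₗ[F] (X × (F × F))) : ℝ) ≤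
        2 * ((Finset.univ.filter fun h : (X × (F × F)) ≃ₗ[F] (X × (F × F)) =>
            rich (g * ext h)).card : ℝ) := by
      intro g hg
      obtain ⟨y, hy⟩ := (Finset.mem_filter.1 hg).2
      have h1 := card_le_two_mul_card_concentrated (F := F)
        (fun v : X × (F × F) => w (g (v.1, (v.2, y)))) (fun v => hw0 _) (fun v => hwW _) hε hε1 hμ
        (by
          rw [hcardP]
          have h2 : ∀ S : ℝ, |S / q ^ 2 - μ| = |S - q ^ 2 * μ| / q ^ 2 := by
            intro S
            rw [← abs_of_pos (show 0 < q ^ 2 by positivity), ← abs_div,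
              abs_of_pos (show 0 < q ^ 2 by positivity), sub_div, mul_div_cancel_left₀]
            positivity
          rw [h2, le_div_iff₀ (by positivity)]
          linarith)
      refine h1.trans ?_
      refine mul_le_mul_of_nonneg_left (Nat.cast_le.2 (Finset.card_le_card fun h hh => ?_))
        (by norm_num)
      rw [Finset.mem_filter] at hh ⊢
      refine ⟨Finset.mem_univ _, y, ?_⟩
      rw [hcardP] at hh
      refine le_trans ?_ (hh.2.trans (mul_le_mul_of_nonneg_right hWθ (by positivity)))
      refine Nat.cast_le.2 (Finset.card_le_card fun s hs => ?_)
      rw [Finset.mem_filter] at hs ⊢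
      refine ⟨Finset.mem_univ _, fun h3 => hs.2 ?_⟩
      exact Finset.mem_filter.2 ⟨Finset.mem_univ _, h3⟩
    refine le_of_mul_le_mul_left ?_ hH
    calc _ = ∑ g ∈ bad, (Fintype.card ((X × (F × F)) ≃ₗ[F] (X × (F × F))) : ℝ) := by
          rw [Finset.sum_const, nsmul_eq_mul, mul_comm]
      _ ≤ ∑ g ∈ bad, 2 * ((Finset.univ.filter fun h : (X × (F × F)) ≃ₗ[F] (X × (F × F)) =>
            rich (g * ext h)).card : ℝ) := Finset.sum_le_sum hg
      _ ≤ ∑ g, 2 * ((Finset.univ.filter fun h : (X × (F × F)) ≃ₗ[F] (X × (F × F)) =>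
            rich (g * ext h)).card : ℝ) :=
          Finset.sum_le_sum_of_subset_of_nonneg (Finset.subset_univ _) fun _ _ _ => by positivity
      _ = _ := by rw [← Finset.mul_sum, ← hcount']; ring
  -- a set of small density is rarely rich
  have hrich_small : ((Finset.univ.filter fun g => rich g ∧
      2 * (dev g).card < Fintype.card ((F × F) × Y)).card : ℝ) ≤ 2 * κ * cG := by
    -- Resampling by these maps fixes the small subspace and relabels its cosets. The deviating set
    -- only moves by `k⁻¹`; equivalently, it stays put while the direction of the plane becomes
    -- random.
    let ext : (((F × F) × Y) ≃ₗ[F] ((F × F) × Y)) →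
        ((X × ((F × F) × Y)) ≃ₗ[F] (X × ((F × F) × Y))) := fun k =>
      (LinearEquiv.refl F X).prodCongr k
    have hext : ∀ k x z, ext k (x, z) = (x, k z) := fun k x z => rfl
    have hdev : ∀ g k z, z ∈ dev (g * ext k) ↔ k z ∈ dev g := by
      intro g k z
      simp only [dev, Finset.mem_filter, Finset.mem_univ, true_and, LinearEquiv.mul_apply, hext]
    have hdevcard : ∀ g k, (dev (g * ext k)).card = (dev g).card := by
      intro g k
      rw [← Finset.card_image_of_injective (dev (g * ext k)) k.injective]
      congr 1
      ext z
      rw [Finset.mem_image]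
      constructor
      · rintro ⟨u, hu, rfl⟩
        exact (hdev g k u).1 hu
      · intro hz
        exact ⟨k.symm z, (hdev g k _).2 (by simpa using hz), by simp⟩
    have hcount := card_mul_card_filter_eq_sum ext fun g => rich g ∧
      2 * (dev g).card < Fintype.card ((F × F) × Y)
    have hK : (0 : ℝ) < Fintype.card (((F × F) × Y) ≃ₗ[F] ((F × F) × Y)) := by
      exact_mod_cast Fintype.card_pos
    have hcount' : (Fintype.card (((F × F) × Y) ≃ₗ[F] ((F × F) × Y)) : ℝ) *
        (Finset.univ.filter fun g => rich g ∧
          2 * (dev g).card < Fintype.card ((F × F) × Y)).card = ∑ g,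
          ((Finset.univ.filter fun k : ((F × F) × Y) ≃ₗ[F] ((F × F) × Y) =>
            rich (g * ext k) ∧
              2 * (dev (g * ext k)).card < Fintype.card ((F × F) × Y)).card : ℝ) := by
      exact_mod_cast hcount
    let b₀ : Fin 2 → (F × F) × Y := ![((1, 0), 0), ((0, 1), 0)]
    have hb₀ : LinearIndependent F b₀ := by
      rw [LinearIndependent.pair_iff]
      intro s t hst
      simp only [Prod.smul_mk, smul_eq_mul, mul_one, mul_zero, smul_zero, Prod.mk_add_mk,
        add_zero, zero_add, Prod.mk_eq_zero] at hst
      exact hst.1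
    have hg : ∀ g, ((Finset.univ.filter fun k : ((F × F) × Y) ≃ₗ[F] ((F × F) × Y) =>
            rich (g * ext k) ∧
              2 * (dev (g * ext k)).card < Fintype.card ((F × F) × Y)).card : ℝ) ≤
        2 * κ * Fintype.card (((F × F) × Y) ≃ₗ[F] ((F × F) × Y)) := by
      intro g
      simp only [hdevcard]
      by_cases hsmall : 2 * (dev g).card < Fintype.card ((F × F) × Y)
      · refine card_automorphisms_rich_le hE (dev g) hsmall κ θ (by omega) hq3
          (by rw [hN]; exact hκ) hθ0 (by rw [hN]; exact hθN) hb₀ _ ?_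
        intro k hk
        obtain ⟨y, hy⟩ := (Finset.mem_filter.1 hk).2.1
        -- The image under `k` of the plane of labels `(s, y)` passes through `k (0, y)` in the
        -- directions `k (b₀ 0)` and `k (b₀ 1)`.
        refine ⟨k (0, y), le_trans (Nat.cast_le.2 (Finset.card_le_card fun s hs => ?_)) hy⟩
        rw [Finset.mem_filter] at hs ⊢
        refine ⟨Finset.mem_univ _, fun h => hs.2 ?_⟩
        rw [hdev] at h
        convert h using 1
        rw [← map_smul, ← map_smul, ← map_add, ← map_add]
        congr 1
        simp [b₀]
      · simp only [hsmall, and_false, Finset.filter_false, Finset.card_empty, Nat.cast_zero]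
        positivity
    refine le_of_mul_le_mul_left ?_ hK
    rw [hcount']
    refine (Finset.sum_le_sum fun g _ => hg g).trans ?_
    rw [Finset.sum_const, nsmul_eq_mul, Finset.card_univ, ← hcG]
    apply le_of_eq; ring
  have hmany := card_many_deviating_fibers_le (F := F) w hw0 hwW hε hμ hμw
  have hsplit : (Finset.univ.filter rich).card ≤
      (Finset.univ.filter fun g => rich g ∧
        2 * (dev g).card < Fintype.card ((F × F) × Y)).card +
      (Finset.univ.filter fun g => Fintype.card ((F × F) × Y) ≤ 2 * (dev g).card).card := by
    refine le_trans (Finset.card_le_card fun g hg => ?_) (Finset.card_union_le _ _)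
    rw [Finset.mem_union, Finset.mem_filter, Finset.mem_filter]
    have h1 := (Finset.mem_filter.1 hg).2
    rcases lt_or_ge (2 * (dev g).card) (Fintype.card ((F × F) × Y)) with h | h
    · exact Or.inl ⟨Finset.mem_univ _, h1, h⟩
    · exact Or.inr ⟨Finset.mem_univ _, h⟩
  have hsplit' : ((Finset.univ.filter rich).card : ℝ) ≤
      (Finset.univ.filter fun g => rich g ∧
        2 * (dev g).card < Fintype.card ((F × F) × Y)).card +
      (Finset.univ.filter fun g => Fintype.card ((F × F) × Y) ≤ 2 * (dev g).card).card := by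
    exact_mod_cast hsplit
  have hmany' : ((Finset.univ.filter fun g => Fintype.card ((F × F) × Y) ≤
      2 * (dev g).card).card : ℝ) ≤ cG * (8 / (ε ^ 2 * q)) := by
    refine hmany.trans (mul_le_mul_of_nonneg_left ?_ hcG0)
    have : 8 * W / (ε ^ 2 * μ) = 64 * W / (ε ^ 2 * μ) / 8 := by ring
    rw [this]
    calc _ ≤ θ / 8 := by linarith
      _ = _ := by rw [hθ]; ring
  have hfin : cG * (16 / (ε ^ 2 * q) + 4 * κ) = 2 * (2 * κ * cG + cG * (8 / (ε ^ 2 * q))) := by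
    ring
  rw [hfin]
  linarith

end RandomSubspaceSmoothness

/-! ### From random automorphisms to random subspaces. -/

section Grassmannian

variable {F : Type*} [Field F]

theorem mem_smul_submodule_iff {V : Type*} [AddCommGroup V] [Module F V] (g : V ≃ₗ[F] V)
    (S : Submodule F V) (v : V) : v ∈ g • S ↔ ∃ u ∈ S, g u = v :=
  Submodule.mem_smul_pointwise_iff_exists v g S

theorem finrank_smul_submodule {V : Type*} [AddCommGroup V] [Module F V] (g : V ≃ₗ[F] V)
    (S : Submodule F V) : Module.finrank F (g • S : Submodule F V) = Module.finrank F S := by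
  have : g • S = S.map g.toLinearMap := by
    ext v
    rw [mem_smul_submodule_iff, Submodule.mem_map]
    rfl
  rw [this]
  exact LinearEquiv.finrank_map_eq g S

theorem exists_linearEquiv_smul_submodule_eq {V : Type*} [AddCommGroup V] [Module F V]
    [FiniteDimensional F V] {S T : Submodule F V}
    (h : Module.finrank F S = Module.finrank F T) : ∃ g : V ≃ₗ[F] V, g • S = T := by
  let f := LinearEquiv.ofFinrankEq S T h
  obtain ⟨g, hg⟩ := Submodule.exists_linearEquiv_restrict_eq f
  refine ⟨g, ?_⟩
  ext v
  rw [mem_smul_submodule_iff]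
  constructor
  · rintro ⟨u, hu, rfl⟩
    rw [← hg ⟨u, hu⟩]
    exact (f ⟨u, hu⟩).2
  · intro hv
    refine ⟨f.symm ⟨v, hv⟩, (f.symm ⟨v, hv⟩).2, ?_⟩
    rw [← hg]
    simp

open Classical in
/-- The number of automorphisms moving a fixed subspace into a family of subspaces of the same
dimension is proportional to the size of the family. -/
theorem ncard_mul_card_filter_smul_eq {V : Type*} [AddCommGroup V] [Module F V] [Finite V]
    (S₀ : Submodule F V) (A : Set (Submodule F V)) :
    ({S : Submodule F V | Module.finrank F S = Module.finrank F S₀}.ncard : ℝ) *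
      (Finset.univ.filter fun g : V ≃ₗ[F] V => g • S₀ ∈ A).card =
    Fintype.card (V ≃ₗ[F] V) *
      ({S : Submodule F V | Module.finrank F S = Module.finrank F S₀ ∧ S ∈ A}.ncard : ℝ) := by
  have : Fintype (Submodule F V) := Fintype.ofFinite _
  have h := card_mul_sum_smul_eq (G := V ≃ₗ[F] V)
    (Finset.univ.filter fun S : Submodule F V => Module.finrank F S = Module.finrank F S₀) ?_ ?_
    (fun S => if S ∈ A then (1 : ℝ) else 0) (x₀ := S₀) (by simp)
  · rw [← Finset.sum_filter, ← Finset.sum_filter, Finset.sum_const, Finset.sum_const, nsmul_eq_mul,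
      nsmul_eq_mul, mul_one, mul_one, Finset.filter_filter] at h
    rw [← Set.ncard_coe_finset, ← Set.ncard_coe_finset (Finset.univ.filter fun S : Submodule F V =>
      Module.finrank F S = Module.finrank F S₀ ∧ S ∈ A)] at h
    simpa using h
  · intro g S hS
    rw [Finset.mem_filter] at hS ⊢
    exact ⟨Finset.mem_univ _, (finrank_smul_submodule g S).trans hS.2⟩
  · intro S hS T hT
    exact exists_linearEquiv_smul_submodule_eq
      ((Finset.mem_filter.1 hS).2.trans (Finset.mem_filter.1 hT).2.symm)

open Classical in
/-- All translates of a random subspace carry about the expected share of a bounded weight. -/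
theorem ncard_deviating_submodules_le {n r p : ℕ} (hp : p.Prime) (hr : 2 ≤ r) (hrn : r ≤ n)
    (w : (Fin n → ZMod p) → ℝ) {W ε κ μ : ℝ} (hw0 : ∀ v, 0 ≤ w v) (hwW : ∀ v, w v ≤ W)
    (hε : 0 < ε) (hε1 : ε ≤ 1) (hμ : 0 < μ) [Fintype (ZMod p)]
    (hμw : (∑ v, w v) * (p : ℝ) ^ r = μ * (p : ℝ) ^ n)
    (hWμ : W * (p : ℝ) ^ 3 ≤ μ) (hκ : 4 * (n : ℝ) ^ 2 ≤ κ * p)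
    (hq : 256 * (n : ℝ) ≤ ε ^ 2 * p) :
    ({S ∈ SmoothCover.grassmannian n r p | ∃ v, ε * μ ≤
        |∑ u with u ∈ S, w (u + v) - μ|}.ncard : ℝ) ≤
      (SmoothCover.grassmannian n r p).ncard * (16 / (ε ^ 2 * p) + 4 * κ) := by
  have : Fact p.Prime := ⟨hp⟩
  have hp0 : (0 : ℝ) < p := by exact_mod_cast hp.pos
  let F := ZMod p
  -- The model subspace is `X × F² × 0`, of dimension `r`. The factor `F²`, which needs `2 ≤ r`,
  -- supplies the planes.
  let X := Fin (r - 2) → F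
  let Y := Fin (n - r) → F
  let V := X × ((F × F) × Y)
  have hrkZ : Module.finrank F ((F × F) × Y) = n - r + 2 := by
    simp [Y]; omega
  have hrkV : Module.finrank F V = n := by
    rw [Module.finrank_prod, hrkZ]
    simp [X]; omega
  let φ : V ≃ₗ[F] (Fin n → F) := LinearEquiv.ofFinrankEq _ _ (by rw [hrkV]; simp)
  let w' : V → ℝ := fun v => w (φ v)
  have : Fintype (GaloisField p 2) := Fintype.ofFinite _
  have hcardF : Fintype.card F = p := ZMod.card p
  have hcardZ : (Fintype.card ((F × F) × Y) : ℝ) = (p : ℝ) ^ (n - r + 2) := by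
    rw [Module.card_eq_pow_finrank (K := F), hrkZ, hcardF]; push_cast; rfl
  have hsum : ∑ v, w' v = ∑ v, w v := φ.toEquiv.sum_comp w
  have hNn : n - r + 2 ≤ n := by omega
  have hNn' : ((n - r + 2 : ℕ) : ℝ) ≤ n := by exact_mod_cast hNn
  -- The cosets of the small subspace have mean mass `μ / p²`, and the second moment needs this to
  -- be at least `W p`. Hence the cube in `W p³ ≤ μ`.
  have hcore := card_deviating_automorphisms_le (E := GaloisField p 2)
    (GaloisField.finrank p two_ne_zero) w' (W := W) (ε := ε) (κ := κ) (μ := μ / (p : ℝ) ^ 2)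
    (N := n - r + 2) (fun v => hw0 _) (fun v => hwW _) hε hε1 (by positivity)
    (by
      rw [hsum, hcardZ, div_mul_eq_mul_div, eq_div_iff (by positivity)]
      refine mul_right_cancel₀ (pow_ne_zero r hp0.ne') ?_
      calc (∑ v, w v) * (p : ℝ) ^ 2 * (p : ℝ) ^ r = ((∑ v, w v) * (p : ℝ) ^ r) * (p : ℝ) ^ 2 := by
            ring
        _ = μ * (p : ℝ) ^ (n - r + r) * (p : ℝ) ^ 2 := by rw [hμw, Nat.sub_add_cancel hrn]
        _ = _ := by ring)
    (by rw [hcardF, le_div_iff₀ (by positivity)]; linarith)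
    hrkZ
    (by
      rw [hcardF]
      refine le_trans ?_ hκ
      have : (0 : ℝ) ≤ ((n - r + 2 : ℕ) : ℝ) := by positivity
      gcongr)
    (by rw [hcardF]; linarith)
  rw [hcardF] at hcore
  rw [mul_div_cancel₀ _ (by positivity : (p : ℝ) ^ 2 ≠ 0)] at hcore
  let S₀ : Submodule F V :=
    LinearMap.ker ((LinearMap.snd F (F × F) Y).comp (LinearMap.snd F X ((F × F) × Y)))
  have hS₀ : ∀ v, v ∈ S₀ ↔ v.2.2 = 0 := fun v => Iff.rfl
  have hrkS₀ : Module.finrank F S₀ = r := by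
    have h1 := LinearMap.finrank_range_add_finrank_ker
      ((LinearMap.snd F (F × F) Y).comp (LinearMap.snd F X ((F × F) × Y)))
    rw [LinearMap.range_eq_top.2, finrank_top, hrkV] at h1
    · have h2 : Module.finrank F Y = n - r := by simp [Y]
      change _ + Module.finrank F S₀ = n at h1
      omega
    · intro y
      exact ⟨(0, (0, y)), rfl⟩
  let A : Set (Submodule F V) := {S | ∃ v, ε * μ ≤ |∑ u with u ∈ S.map φ.toLinearMap, w (u + v) - μ|}
  -- A coset of `g • S₀` is determined by the `Y`-coordinate of any representative pulled back by
  -- `g`.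
  have hA : ∀ g : V ≃ₗ[F] V, g • S₀ ∈ A ↔ ∃ y : Y, ε * μ ≤
      |∑ v : X × (F × F), w' (g (v.1, (v.2, y))) - μ| := by
    intro g
    have hsumS : ∀ (x₀ : X) (s₀ : F × F) (y : Y),
        ∑ u with u ∈ (g • S₀).map φ.toLinearMap, w (u + φ (g (x₀, (s₀, y)))) =
          ∑ v : X × (F × F), w' (g (v.1, (v.2, y))) := by
      intro x₀ s₀ y
      have h1 : ∑ v : X × (F × F), w (φ (g (v.1, (v.2, 0))) + φ (g (x₀, (s₀, y)))) =
          ∑ u with u ∈ (g • S₀).map φ.toLinearMap, w (u + φ (g (x₀, (s₀, y)))) := by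
        refine Finset.sum_bij (fun v _ => φ (g (v.1, (v.2, 0)))) ?_ ?_ ?_ ?_
        · intro v _
          rw [Finset.mem_filter]
          refine ⟨Finset.mem_univ _, Submodule.mem_map.2 ⟨_, ?_, rfl⟩⟩
          exact (mem_smul_submodule_iff _ _ _).2 ⟨_, (hS₀ _).2 rfl, rfl⟩
        · intro v _ v' _ h
          have := g.injective (φ.injective h)
          exact Prod.ext (congrArg (fun t : V => t.1) this) (congrArg (fun t : V => t.2.1) this)
        · intro u hu
          obtain ⟨t, ht, rfl⟩ := Submodule.mem_map.1 (Finset.mem_filter.1 hu).2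
          obtain ⟨⟨x, s, y'⟩, hv, rfl⟩ := (mem_smul_submodule_iff _ _ _).1 ht
          have hy' : y' = 0 := (hS₀ _).1 hv
          exact ⟨(x, s), Finset.mem_univ _, by rw [hy']; rfl⟩
        · intro v _; rfl
      rw [← h1]
      refine Fintype.sum_equiv (Equiv.addRight (x₀, s₀)) _ _ fun v => ?_
      have h2 : ((v.1, (v.2, 0)) + (x₀, (s₀, y)) : V) = (v.1 + x₀, (v.2 + s₀, y)) :=
        Prod.ext rfl (Prod.ext rfl (zero_add y))
      rw [← map_add, ← map_add, h2]
      rfl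
    constructor
    · rintro ⟨v, hv⟩
      obtain ⟨⟨x₀, s₀, y⟩, hxy⟩ : ∃ t, φ (g t) = v := ⟨g.symm (φ.symm v), by simp⟩
      rw [← hxy, hsumS] at hv
      exact ⟨y, hv⟩
    · rintro ⟨y, hy⟩
      exact ⟨φ (g (0, (0, y))), by rw [hsumS]; exact hy⟩
  have htrans := ncard_mul_card_filter_smul_eq S₀ A
  simp only [hA, hrkS₀] at htrans
  let mapφ : Submodule F V → Submodule F (Fin n → F) := fun S => S.map φ.toLinearMap
  have hmapφ : Function.Injective mapφ := Submodule.map_injective_of_injective φ.injective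
  have hmapsurj : ∀ T : Submodule F (Fin n → F), ∃ S, mapφ S = T := fun T =>
    ⟨T.comap φ.toLinearMap, Submodule.map_comap_eq_of_surjective φ.surjective T⟩
  have hrkmap : ∀ S, Module.finrank F (mapφ S) = Module.finrank F S := fun S =>
    LinearEquiv.finrank_map_eq φ S
  have hgr : (SmoothCover.grassmannian n r p).ncard =
      {S : Submodule F V | Module.finrank F S = r}.ncard := by
    rw [← Set.ncard_image_of_injective _ hmapφ]
    congr 1
    ext T
    constructor
    · intro hT
      obtain ⟨S, rfl⟩ := hmapsurj T
      exact ⟨S, (hrkmap S).symm.trans hT, rfl⟩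
    · rintro ⟨S, hS, rfl⟩
      exact (hrkmap S).trans hS
  have hgrA : {S ∈ SmoothCover.grassmannian n r p | ∃ v, ε * μ ≤
        |∑ u with u ∈ S, w (u + v) - μ|}.ncard =
      {S : Submodule F V | Module.finrank F S = r ∧ S ∈ A}.ncard := by
    rw [← Set.ncard_image_of_injective _ hmapφ]
    congr 1
    ext T
    constructor
    · rintro ⟨hT, hT'⟩
      obtain ⟨S, rfl⟩ := hmapsurj T
      exact ⟨S, ⟨(hrkmap S).symm.trans hT, hT'⟩, rfl⟩
    · rintro ⟨S, ⟨hS, hS'⟩, rfl⟩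
      exact ⟨(hrkmap S).trans hS, hS'⟩
  rw [hgr, hgrA]
  have hG : (0 : ℝ) < Fintype.card (V ≃ₗ[F] V) := by exact_mod_cast Fintype.card_pos
  refine le_of_mul_le_mul_left ?_ hG
  rw [← htrans, mul_left_comm]
  exact mul_le_mul_of_nonneg_left hcore (Nat.cast_nonneg _)

end Grassmannian

/-! ### Covolumes of construction A lattices. -/

section Covolume

open MeasureTheory

theorem volume_setOf_forall_mem_Ico {n : ℕ} (a b : Fin n → ℝ) :
    volume {x : SmoothCover.Euc n | ∀ i, x i ∈ Set.Ico (a i) (b i)} =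
      ∏ i, ENNReal.ofReal (b i - a i) := by
  rw [← Real.volume_pi_Ico, ← (EuclideanSpace.volume_preserving_symm_measurableEquiv_toLp
    (Fin n)).measure_preimage
      (MeasurableSet.univ_pi fun i => measurableSet_Ico).nullMeasurableSet]
  congr 1
  ext x
  simp only [Set.mem_ofPred_eq, Set.mem_preimage, Set.mem_univ_pi]
  rfl

/-- The vector of `ℝ ^ n` with given integer coordinates. -/
noncomputable def intVec (n : ℕ) : (Fin n → ℤ) →+ SmoothCover.Euc n where
  toFun z := WithLp.toLp 2 fun i => (z i : ℝ)
  map_zero' := by ext i; simp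
  map_add' z w := by ext i; simp

@[simp]
theorem intVec_apply {n : ℕ} (z : Fin n → ℤ) (i : Fin n) : intVec n z i = z i := rfl

theorem intVec_injective (n : ℕ) : Function.Injective (intVec n) := by
  intro z w h
  funext i
  have := congrArg (fun x : SmoothCover.Euc n => x i) h
  simpa using this

/-- Coordinatewise reduction modulo `p`. -/
def reduceMod (n p : ℕ) : (Fin n → ℤ) →+ (Fin n → ZMod p) where
  toFun z i := z i
  map_zero' := by ext i; simp
  map_add' z w := by ext i; simp

theorem reduceMod_surjective (n p : ℕ) : Function.Surjective (reduceMod n p) := by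
  intro v
  choose z hz using fun i => ZMod.intCast_surjective (v i)
  exact ⟨z, funext hz⟩

/-- The lattice of integer vectors. -/
noncomputable def integerLattice (n : ℕ) : Submodule ℤ (SmoothCover.Euc n) :=
  Submodule.span ℤ (Set.range (EuclideanSpace.basisFun (Fin n) ℝ).toBasis)

instance (n : ℕ) : DiscreteTopology (integerLattice n) := by
  unfold integerLattice; infer_instance

instance (n : ℕ) : IsZLattice ℝ (integerLattice n) := by
  unfold integerLattice; infer_instance

theorem mem_integerLattice {n : ℕ} {x : SmoothCover.Euc n} :
    x ∈ integerLattice n ↔ ∃ z, x = intVec n z := by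
  rw [integerLattice, Module.Basis.mem_span_iff_repr_mem]
  constructor
  · intro h
    choose z hz using h
    refine ⟨z, ?_⟩
    ext i
    simpa using (hz i).symm
  · rintro ⟨z, rfl⟩ i
    exact ⟨z i, by simp⟩

theorem covolume_integerLattice (n : ℕ) : ZLattice.covolume (integerLattice n) = 1 := by
  have h := ZLattice.covolume_eq_measure_fundamentalDomain (integerLattice n) volume
    (ZSpan.isAddFundamentalDomain (EuclideanSpace.basisFun (Fin n) ℝ).toBasis volume)
  rw [h, measureReal_def]
  have : ZSpan.fundamentalDomain (EuclideanSpace.basisFun (Fin n) ℝ).toBasis =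
      {x : SmoothCover.Euc n | ∀ i, x i ∈ Set.Ico ((0 : Fin n → ℝ) i) ((1 : Fin n → ℝ) i)} := by
    ext x
    rw [ZSpan.mem_fundamentalDomain]
    simp
  rw [this, volume_setOf_forall_mem_Ico]
  simp

theorem reductionPreimage_le_integerLattice {n : ℕ} (p : ℕ)
    (S : Submodule (ZMod p) (Fin n → ZMod p)) :
    SmoothCover.reductionPreimage p S ≤ integerLattice n := by
  rintro x ⟨z, -, rfl⟩
  exact mem_integerLattice.2 ⟨z, rfl⟩

instance discreteTopology_reductionPreimage {n p : ℕ} (S : Submodule (ZMod p) (Fin n → ZMod p)) :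
    DiscreteTopology (SmoothCover.reductionPreimage p S) :=
  DiscreteTopology.of_subset (inferInstanceAs (DiscreteTopology (integerLattice n)))
    (reductionPreimage_le_integerLattice p S)

theorem isZLattice_reductionPreimage {n p : ℕ} (hp : p ≠ 0)
    (S : Submodule (ZMod p) (Fin n → ZMod p)) :
    IsZLattice ℝ (SmoothCover.reductionPreimage p S) where
  span_top := by
    rw [← top_le_iff, ← (EuclideanSpace.basisFun (Fin n) ℝ).toBasis.span_eq, Submodule.span_le]
    rintro _ ⟨i, rfl⟩
    have h1 : (p : ℝ) • (EuclideanSpace.basisFun (Fin n) ℝ).toBasis i ∈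
        (SmoothCover.reductionPreimage p S : Set (SmoothCover.Euc n)) := by
      refine ⟨Pi.single i (p : ℤ), ?_, ?_⟩
      · convert S.zero_mem using 1
        funext j
        by_cases h : j = i
        · subst h; simp
        · simp [h]
      · ext j
        by_cases h : j = i
        · subst h; simp
        · simp [h]
    have h2 := Submodule.smul_mem (Submodule.span ℝ
      (SmoothCover.reductionPreimage p S : Set (SmoothCover.Euc n))) (p : ℝ)⁻¹
      (Submodule.subset_span h1)
    rwa [inv_smul_smul₀ (by exact_mod_cast hp)] at h2

/-- The index of the preimage in the integer lattice equals that of `S` in `𝔽_p ^ n`, since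
reduction is surjective. The product form avoids the exponent `n - r`. -/
theorem covolume_reductionPreimage {n p r : ℕ} (hp : p.Prime)
    {S : Submodule (ZMod p) (Fin n → ZMod p)} (hS : S ∈ SmoothCover.grassmannian n r p) :
    ZLattice.covolume (SmoothCover.reductionPreimage p S) * (p : ℝ) ^ r = (p : ℝ) ^ n := by
  have : Fact p.Prime := ⟨hp⟩
  have := isZLattice_reductionPreimage hp.ne_zero S
  have h := ZLattice.covolume_div_covolume_eq_relIndex' _ _
    (reductionPreimage_le_integerLattice p S)
  have h1 : (SmoothCover.reductionPreimage p S).toAddSubgroup =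
      (S.toAddSubgroup.comap (reduceMod n p)).map (intVec n) := by
    ext x
    rw [AddSubgroup.mem_map]
    constructor
    · rintro ⟨z, hz, rfl⟩
      exact ⟨z, hz, rfl⟩
    · rintro ⟨z, hz, rfl⟩
      exact ⟨z, hz, rfl⟩
  have h2 : (integerLattice n).toAddSubgroup = (⊤ : AddSubgroup (Fin n → ℤ)).map (intVec n) := by
    ext x
    rw [AddSubgroup.mem_map, Submodule.mem_toAddSubgroup, mem_integerLattice]
    constructor
    · rintro ⟨z, rfl⟩
      exact ⟨z, trivial, rfl⟩
    · rintro ⟨z, -, rfl⟩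
      exact ⟨z, rfl⟩
  rw [covolume_integerLattice, div_one, h1, h2,
    AddSubgroup.relIndex_map_map_of_injective _ _ (intVec_injective n),
    AddSubgroup.relIndex_top_right,
    AddSubgroup.index_comap_of_surjective _ (reduceMod_surjective n p)] at h
  rw [h]
  have h3 := S.toAddSubgroup.card_mul_index
  have h4 : Nat.card S.toAddSubgroup = p ^ r := by
    change Nat.card S = _
    have : Module.finrank (ZMod p) S = r := hS
    rw [Module.natCard_eq_pow_finrank (K := ZMod p), this, Nat.card_zmod]
  rw [h4, Nat.card_fun, Nat.card_zmod, Nat.card_fin, mul_comm] at h3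
  exact_mod_cast h3

theorem covolume_smul {n : ℕ} (L : Submodule ℤ (SmoothCover.Euc n)) [DiscreteTopology L]
    [IsZLattice ℝ L] {c : ℝ} (hc : 0 < c) :
    ZLattice.covolume (c • L) = c ^ n * ZLattice.covolume L := by
  let e : SmoothCover.Euc n ≃L[ℝ] SmoothCover.Euc n :=
    ContinuousLinearEquiv.smulLeft (Units.mk0 c⁻¹ (inv_ne_zero hc.ne'))
  have he : ∀ x, e x = c⁻¹ • x := fun x => rfl
  have hes : ∀ x, e.symm x = c • x := fun x => by
    rw [ContinuousLinearEquiv.symm_apply_eq, he, inv_smul_smul₀ hc.ne']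
  have hL : c • L = ZLattice.comap ℝ L e.toLinearMap := by
    ext x
    rw [Submodule.mem_smul_pointwise_iff_exists]
    constructor
    · rintro ⟨y, hy, rfl⟩
      change c⁻¹ • c • y ∈ L
      rwa [inv_smul_smul₀ hc.ne']
    · intro hx
      exact ⟨c⁻¹ • x, hx, smul_inv_smul₀ hc.ne' x⟩
  rw [hL, ZLattice.covolume_eq_measure_fundamentalDomain _ _
      (ZLattice.isAddFundamentalDomain (Module.Free.chooseBasis ℤ L) volume),
    ZLattice.covolume_eq_measure_fundamentalDomain _ _ ((ZLattice.isAddFundamentalDomain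
    ((Module.Free.chooseBasis ℤ L).ofZLatticeComap ℝ L e.toLinearEquiv) volume))]
  have h1 : ZSpan.fundamentalDomain (((Module.Free.chooseBasis ℤ L).ofZLatticeComap ℝ L
      e.toLinearEquiv).ofZLatticeBasis ℝ (ZLattice.comap ℝ L e.toLinearMap)) =
      c • ZSpan.fundamentalDomain ((Module.Free.chooseBasis ℤ L).ofZLatticeBasis ℝ L) := by
    have h2 : c • ZSpan.fundamentalDomain ((Module.Free.chooseBasis ℤ L).ofZLatticeBasis ℝ L) =
        e.symm.toLinearEquiv '' ZSpan.fundamentalDomain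
          ((Module.Free.chooseBasis ℤ L).ofZLatticeBasis ℝ L) := by
      ext x
      constructor
      · rintro ⟨y, hy, rfl⟩
        exact ⟨y, hy, hes y⟩
      · rintro ⟨y, hy, rfl⟩
        exact ⟨y, hy, (hes y).symm⟩
    rw [h2, ZSpan.map_fundamentalDomain]
    congr 1
    ext i
    simp [hes]
  rw [h1, measureReal_def, Measure.addHaar_smul, ENNReal.toReal_mul, ENNReal.toReal_ofReal
    (abs_nonneg _), abs_of_pos (by positivity), measureReal_def]
  simp

theorem covolume_scaled_constructionA {n p r : ℕ} (hn : n ≠ 0) (hp : p.Prime)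
    {S : Submodule (ZMod p) (Fin n → ZMod p)} (hS : S ∈ SmoothCover.grassmannian n r p) :
    ZLattice.covolume ((p : ℝ) ^ ((r : ℝ) / n) • SmoothCover.constructionA p S) = 1 := by
  have hp0 : (0 : ℝ) < p := by exact_mod_cast hp.pos
  have := isZLattice_reductionPreimage hp.ne_zero S
  have hn0 : (n : ℝ) ≠ 0 := by exact_mod_cast hn
  rw [SmoothCover.constructionA, smul_smul, covolume_smul _ (by positivity), mul_pow,
    ← Real.rpow_natCast ((p : ℝ) ^ ((r : ℝ) / n)), ← Real.rpow_mul hp0.le,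
    div_mul_cancel₀ _ hn0, Real.rpow_natCast, mul_right_comm, mul_comm ((p : ℝ) ^ r),
    covolume_reductionPreimage hp hS, ← mul_pow, mul_one_div_cancel hp0.ne', one_pow]

end Covolume

/-! ### Integer points in balls and their residues. -/

section LatticePointCount

open MeasureTheory

/-- The integer vectors in a closed ball. -/
def intPoints (n : ℕ) (c : SmoothCover.Euc n) (ρ : ℝ) : Set (Fin n → ℤ) :=
  {z | ‖intVec n z - c‖ ≤ ρ}

theorem intPoints_finite (n : ℕ) (c : SmoothCover.Euc n) (ρ : ℝ) : (intPoints n c ρ).Finite := by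
  refine (Set.finite_Icc (fun i => ⌊c i - ρ⌋) (fun i => ⌈c i + ρ⌉)).subset fun z hz => ?_
  have h : ∀ i, |(z i : ℝ) - c i| ≤ ρ := fun i => by
    have h1 := PiLp.norm_apply_le (intVec n z - c) i
    have h2 : (intVec n z - c) i = (z i : ℝ) - c i := rfl
    rw [h2, Real.norm_eq_abs] at h1
    exact h1.trans hz
  constructor
  · intro i
    have := (abs_le.1 (h i)).1
    have h2 : (⌊c i - ρ⌋ : ℝ) ≤ z i := (Int.floor_le _).trans (by linarith)
    exact Int.cast_le.1 h2
  · intro i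
    have := (abs_le.1 (h i)).2
    have h2 : (z i : ℝ) ≤ ⌈c i + ρ⌉ := le_trans (by linarith) (Int.le_ceil _)
    exact Int.cast_le.1 h2

/-- The integer vector obtained by rounding the coordinates. -/
noncomputable def roundVec {n : ℕ} (x : SmoothCover.Euc n) : Fin n → ℤ := fun i => round (x i)

theorem norm_intVec_roundVec_sub_le {n : ℕ} (x : SmoothCover.Euc n) :
    ‖intVec n (roundVec x) - x‖ ≤ √n / 2 := by
  rw [EuclideanSpace.norm_eq, show √(n : ℝ) / 2 = √((n : ℝ) * (1 / 2) ^ 2) by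
    rw [Real.sqrt_mul (by positivity), Real.sqrt_sq (by norm_num)]; ring]
  refine Real.sqrt_le_sqrt ?_
  calc ∑ i, ‖(intVec n (roundVec x) - x) i‖ ^ 2 ≤ ∑ _i : Fin n, ((1 : ℝ) / 2) ^ 2 := by
        refine Finset.sum_le_sum fun i _ => pow_le_pow_left₀ (norm_nonneg _) ?_ 2
        have h2 : (intVec n (roundVec x) - x) i = (round (x i) : ℝ) - x i := rfl
        rw [h2, Real.norm_eq_abs, abs_sub_comm]
        exact abs_sub_round (x i)
    _ = _ := by rw [Finset.sum_const, Finset.card_univ, Fintype.card_fin, nsmul_eq_mul]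

theorem volume_roundVec_fiber {n : ℕ} (z : Fin n → ℤ) :
    MeasurableSet {x : SmoothCover.Euc n | roundVec x = z} ∧
      volume {x : SmoothCover.Euc n | roundVec x = z} = 1 := by
  have h : {x : SmoothCover.Euc n | roundVec x = z} =
      {x | ∀ i, x i ∈ Set.Ico ((z i : ℝ) - 1 / 2) (z i + 1 / 2)} := by
    ext x
    rw [Set.mem_ofPred_eq, Set.mem_ofPred_eq, funext_iff]
    refine forall_congr' fun i => ?_
    rw [roundVec, round_eq, Int.floor_eq_iff, Set.mem_Ico]
    constructor <;> rintro ⟨h1, h2⟩ <;> constructor <;> linarith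
  rw [h]
  constructor
  · have : {x : SmoothCover.Euc n | ∀ i, x i ∈ Set.Ico ((z i : ℝ) - 1 / 2) (z i + 1 / 2)} =
        ⋂ i, (fun x : SmoothCover.Euc n => x i) ⁻¹' Set.Ico ((z i : ℝ) - 1 / 2) (z i + 1 / 2) := by
      ext x; simp
    rw [this]
    exact MeasurableSet.iInter fun i => measurableSet_Ico.preimage (by fun_prop)
  · rw [volume_setOf_forall_mem_Ico]
    refine Finset.prod_eq_one fun i _ => ?_
    rw [ENNReal.ofReal_eq_one]
    ring

theorem volume_roundVec_preimage {n : ℕ} (C : Set (Fin n → ℤ)) (hC : C.Finite) :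
    volume {x : SmoothCover.Euc n | roundVec x ∈ C} = C.ncard := by
  have h : {x : SmoothCover.Euc n | roundVec x ∈ C} =
      ⋃ z ∈ hC.toFinset, {x : SmoothCover.Euc n | roundVec x = z} := by
    ext x; simp
  rw [h, measure_biUnion_finset]
  · rw [Finset.sum_congr rfl fun z _ => (volume_roundVec_fiber z).2, Finset.sum_const,
      nsmul_eq_mul, mul_one, Set.ncard_eq_toFinset_card C hC]
  · intro z _ z' _ hzz'
    rw [Function.onFun, Set.disjoint_left]
    intro x hx hx'
    exact hzz' (Eq.trans (Eq.symm hx) hx')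
  · exact fun z _ => (volume_roundVec_fiber z).1

/-- The volume of the unit ball. -/
noncomputable def unitBallVolume (n : ℕ) : ℝ :=
  volume.real (Metric.closedBall (0 : SmoothCover.Euc n) 1)

theorem volume_real_closedBall_eq {n : ℕ} (c : SmoothCover.Euc n) {ρ : ℝ} (hρ : 0 ≤ ρ) :
    volume.real (Metric.closedBall c ρ) = ρ ^ n * unitBallVolume n := by
  rw [unitBallVolume, Measure.addHaar_real_closedBall _ _ hρ,
    Measure.addHaar_real_closedBall _ _ zero_le_one]
  simp

theorem unitBallVolume_pos (n : ℕ) : 0 < unitBallVolume n :=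
  ENNReal.toReal_pos (Metric.measure_closedBall_pos _ _ one_pos).ne'
    measure_closedBall_lt_top.ne

/-- Comparison with a cube of side four. The crude bound is enough for `radius_lower_bound`. -/
theorem unitBallVolume_le (n : ℕ) : unitBallVolume n ≤ 4 ^ n := by
  have h : Metric.closedBall (0 : SmoothCover.Euc n) 1 ⊆
      {x : SmoothCover.Euc n | ∀ i, x i ∈ Set.Ico ((-2 : ℝ)) 2} := by
    intro x hx i
    have h1 := (PiLp.norm_apply_le x i).trans (mem_closedBall_zero_iff.1 hx)
    rw [Real.norm_eq_abs, abs_le] at h1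
    constructor <;> linarith [h1.1, h1.2]
  have h2 := measure_mono (μ := volume) h
  rw [volume_setOf_forall_mem_Ico] at h2
  rw [unitBallVolume, measureReal_def]
  refine ENNReal.toReal_le_of_le_ofReal (by positivity) (h2.trans ?_)
  rw [Finset.prod_const, Finset.card_univ, Fintype.card_fin, ENNReal.ofReal_pow (by norm_num)]
  norm_num

/-- The unit cells centred at the counted points are disjoint and lie in the ball enlarged by half
their diagonal, `√n / 2`. The lower bound in `le_ncard_intPoints` is the dual covering statement. -/
theorem ncard_intPoints_le {n : ℕ} (c : SmoothCover.Euc n) {ρ : ℝ} (hρ : 0 ≤ ρ) :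
    ((intPoints n c ρ).ncard : ℝ) ≤ (ρ + √n / 2) ^ n * unitBallVolume n := by
  have h : {x : SmoothCover.Euc n | roundVec x ∈ intPoints n c ρ} ⊆
      Metric.closedBall c (ρ + √n / 2) := by
    intro x hx
    rw [Metric.mem_closedBall, dist_eq_norm]
    have h1 : ‖intVec n (roundVec x) - c‖ ≤ ρ := hx
    have h2 := norm_intVec_roundVec_sub_le x
    calc ‖x - c‖ = ‖(intVec n (roundVec x) - c) - (intVec n (roundVec x) - x)‖ := by
          congr 1; abel
      _ ≤ _ := norm_sub_le _ _
      _ ≤ _ := add_le_add h1 h2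
  rw [← volume_real_closedBall_eq c (by positivity)]
  have := measureReal_mono (μ := volume) h measure_closedBall_lt_top.ne
  rw [measureReal_def, volume_roundVec_preimage _ (intPoints_finite n c ρ)] at this
  simpa using this

theorem le_ncard_intPoints {n : ℕ} (c : SmoothCover.Euc n) {ρ : ℝ} (hρ : √n / 2 ≤ ρ) :
    (ρ - √n / 2) ^ n * unitBallVolume n ≤ ((intPoints n c ρ).ncard : ℝ) := by
  have h : Metric.closedBall c (ρ - √n / 2) ⊆
      {x : SmoothCover.Euc n | roundVec x ∈ intPoints n c ρ} := by
    intro x hx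
    rw [Metric.mem_closedBall, dist_eq_norm] at hx
    have h2 := norm_intVec_roundVec_sub_le x
    change ‖intVec n (roundVec x) - c‖ ≤ ρ
    calc ‖intVec n (roundVec x) - c‖ = ‖(x - c) + (intVec n (roundVec x) - x)‖ := by
          congr 1; abel
      _ ≤ _ := norm_add_le _ _
      _ ≤ _ := by linarith
  rw [← volume_real_closedBall_eq c (by linarith)]
  have h1 := volume_roundVec_preimage _ (intPoints_finite n c ρ)
  have := measureReal_mono h (by rw [h1]; exact ENNReal.natCast_ne_top _)
  rw [measureReal_def (s := {x : SmoothCover.Euc n | roundVec x ∈ intPoints n c ρ}), h1] at this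
  simpa using this

/-- The number of integer vectors in a centered ball with prescribed residue modulo `p`. -/
noncomputable def residueWeight (n p : ℕ) (ρ : ℝ) (v : Fin n → ZMod p) : ℝ :=
  ((intPoints n 0 ρ ∩ {z | reduceMod n p z = v}).ncard : ℝ)

theorem residueWeight_nonneg (n p : ℕ) (ρ : ℝ) (v : Fin n → ZMod p) :
    0 ≤ residueWeight n p ρ v := Nat.cast_nonneg _

theorem sum_residueWeight_eq {n p : ℕ} (ρ : ℝ) (A : Finset (Fin n → ZMod p)) (v : Fin n → ZMod p) :
    ∑ u ∈ A, residueWeight n p ρ (u + v) =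
      ((intPoints n 0 ρ ∩ {z | reduceMod n p z - v ∈ A}).ncard : ℝ) := by
  have hfin := intPoints_finite n 0 ρ
  have h1 : ∀ (Q : (Fin n → ℤ) → Prop) [DecidablePred Q], (intPoints n 0 ρ ∩ {z | Q z}).ncard =
      (hfin.toFinset.filter Q).card := by
    intro Q _
    rw [← Set.ncard_coe_finset]
    congr 1
    ext z; simp
  simp only [residueWeight, h1]
  refine Eq.trans ?_ (congrArg Nat.cast (Finset.card_eq_sum_card_fiberwise
    (f := fun z => reduceMod n p z - v) (t := A)
    (fun z hz => (Finset.mem_filter.1 hz).2)).symm)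
  push_cast
  refine Finset.sum_congr rfl fun u hu => ?_
  rw [Finset.filter_filter]
  congr 2
  refine Finset.filter_congr fun z _ => ?_
  constructor
  · intro h
    rw [h]
    simpa using hu
  · rintro ⟨-, h⟩
    rw [← h, sub_add_cancel]

/-- Distinct congruent vectors differ by at least `p` in some coordinate, more than the diameter of
the ball. -/
theorem residueWeight_le_one {n p : ℕ} {ρ : ℝ} (hρ : 2 * ρ < p)
    (v : Fin n → ZMod p) : residueWeight n p ρ v ≤ 1 := by
  have : (intPoints n 0 ρ ∩ {z | reduceMod n p z = v}).ncard ≤ 1 := by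
    rw [Set.ncard_le_one_iff ((intPoints_finite n 0 ρ).subset Set.inter_subset_left)]
    rintro z z' ⟨hz, hzv⟩ ⟨hz', hzv'⟩
    by_contra hne
    obtain ⟨i, hi⟩ := Function.ne_iff.1 hne
    have h1 : ((z i : ℤ) : ZMod p) = (z' i : ZMod p) := by
      have h2 : reduceMod n p z = reduceMod n p z' := hzv.trans hzv'.symm
      exact congrFun h2 i
    rw [ZMod.intCast_eq_intCast_iff_dvd_sub] at h1
    have h3 := Int.le_of_dvd (abs_pos.2 (sub_ne_zero.2 (Ne.symm hi))) ((dvd_abs _ _).2 h1)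
    have h4 : (p : ℝ) ≤ |(z' i : ℝ) - z i| := by exact_mod_cast h3
    have h5 := PiLp.norm_apply_le (intVec n z' - intVec n z) i
    have h6 : (intVec n z' - intVec n z) i = (z' i : ℝ) - z i := rfl
    rw [h6, Real.norm_eq_abs] at h5
    have h7 : ‖intVec n z - 0‖ ≤ ρ := hz
    have h8 : ‖intVec n z' - 0‖ ≤ ρ := hz'
    rw [sub_zero] at h7 h8
    have h9 := norm_sub_le (intVec n z') (intVec n z)
    linarith
  rw [residueWeight]
  exact_mod_cast this

/-- A residue class is a translate of `p ℤ ^ n`. Dividing by `p` leaves a count of integer points in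
a ball of radius `ρ / p`. -/
theorem residueWeight_le {n p : ℕ} (hp : p ≠ 0) {ρ : ℝ} (hρ : 0 ≤ ρ) (v : Fin n → ZMod p) :
    residueWeight n p ρ v ≤ (ρ / p + √n / 2) ^ n * unitBallVolume n := by
  have hp0 : (0 : ℝ) < p := by exact_mod_cast Nat.pos_of_ne_zero hp
  obtain ⟨v₀, hv₀⟩ := reduceMod_surjective n p v
  refine le_trans ?_ (ncard_intPoints_le (-((p : ℝ)⁻¹ • intVec n v₀)) (by positivity))
  rw [residueWeight, Nat.cast_le]
  have hsub : intPoints n 0 ρ ∩ {z | reduceMod n p z = v} ⊆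
      (fun t : Fin n → ℤ => v₀ + (p : ℤ) • t) ''
        intPoints n (-((p : ℝ)⁻¹ • intVec n v₀)) (ρ / p) := by
    rintro z ⟨hz, hzv⟩
    have h1 : ∀ i, (p : ℤ) ∣ z i - v₀ i := by
      intro i
      have h2 : reduceMod n p v₀ = reduceMod n p z := hv₀.trans (Eq.symm hzv)
      exact (ZMod.intCast_eq_intCast_iff_dvd_sub _ _ _).1 (congrFun h2 i)
    choose t ht using h1
    have hzt : z = v₀ + (p : ℤ) • t := by
      funext i
      have := ht i
      simp only [Pi.add_apply, Pi.smul_apply, smul_eq_mul]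
      linarith
    refine ⟨t, ?_, hzt.symm⟩
    have h3 : intVec n t - -((p : ℝ)⁻¹ • intVec n v₀) = (p : ℝ)⁻¹ • intVec n z := by
      rw [hzt]
      ext i
      simp
      field_simp
      ring
    change ‖_‖ ≤ _
    rw [h3, norm_smul, norm_inv, Real.norm_of_nonneg hp0.le, inv_mul_eq_div]
    have h4 : ‖intVec n z - 0‖ ≤ ρ := hz
    rw [sub_zero] at h4
    gcongr
  exact (Set.ncard_le_ncard hsub ((intPoints_finite _ _ _).image _)).trans
    (Set.ncard_image_le (intPoints_finite _ _ _))

/-- Counting points of the scaled lattice in a translated ball is counting integer vectors. -/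
theorem pointCount_scaled_constructionA {n p : ℕ} (hp : p ≠ 0) {c α : ℝ} (hc : 0 < c) (hα : 0 < α)
    (S : Submodule (ZMod p) (Fin n → ZMod p)) (x : SmoothCover.Euc n) :
    SmoothCover.pointCount (c • SmoothCover.constructionA p S)
      (α • Metric.closedBall (0 : SmoothCover.Euc n) 1) x =
    (intPoints n ((p / c) • x) (α * (p / c)) ∩ {z | reduceMod n p z ∈ S}).ncard := by
  have hp0 : (0 : ℝ) < p := by exact_mod_cast Nat.pos_of_ne_zero hp
  have hinj : Function.Injective fun z => (c / p) • intVec n z := fun z z' h =>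
    intVec_injective n (smul_right_injective _ (by positivity : c / p ≠ 0) h)
  rw [SmoothCover.pointCount, ← Set.ncard_image_of_injective _ hinj]
  congr 1
  ext y
  have hball : ∀ z, (c / p) • intVec n z ∈ α • Metric.closedBall (0 : SmoothCover.Euc n) 1 + {x} ↔
      z ∈ intPoints n ((p / c) • x) (α * (p / c)) := by
    intro z
    rw [smul_unitClosedBall_of_nonneg hα.le, Set.add_singleton, Set.image_add_right,
      Set.mem_preimage, mem_closedBall_zero_iff]
    have h1 : (c / p) • intVec n z + -x = (c / p) • (intVec n z - (p / c) • x) := by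
      rw [smul_sub, smul_smul, div_mul_div_cancel₀ hp0.ne', div_self hc.ne', one_smul, sub_eq_add_neg]
    rw [h1, norm_smul, Real.norm_of_nonneg (by positivity)]
    change _ ↔ ‖_‖ ≤ _
    rw [← le_div_iff₀' (by positivity), div_div_eq_mul_div, mul_div_assoc]
  constructor
  · rintro ⟨hy, hyb⟩
    rw [SmoothCover.constructionA, smul_smul, SetLike.mem_coe,
      Submodule.mem_smul_pointwise_iff_exists] at hy
    obtain ⟨_, ⟨z, hz, rfl⟩, rfl⟩ := hy
    rw [mul_one_div] at hyb ⊢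
    exact ⟨z, ⟨(hball z).1 hyb, hz⟩, rfl⟩
  · rintro ⟨z, ⟨hz, hzS⟩, rfl⟩
    refine ⟨?_, (hball z).2 hz⟩
    rw [SmoothCover.constructionA, smul_smul, SetLike.mem_coe,
      Submodule.mem_smul_pointwise_iff_exists]
    exact ⟨intVec n z, ⟨z, hzS, rfl⟩, by rw [mul_one_div]⟩

/-- The number of points in a translated ball lies between two coset sums. -/
theorem ncard_intPoints_coset_mem_Icc {n p : ℕ} (ρ : ℝ) (S : Submodule (ZMod p) (Fin n → ZMod p))
    (y : SmoothCover.Euc n) : ∃ v : Fin n → ZMod p,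
      (intPoints n 0 (ρ - √n / 2) ∩ {z | reduceMod n p z - v ∈ S}).ncard ≤
        (intPoints n y ρ ∩ {z | reduceMod n p z ∈ S}).ncard ∧
      (intPoints n y ρ ∩ {z | reduceMod n p z ∈ S}).ncard ≤
        (intPoints n 0 (ρ + √n / 2) ∩ {z | reduceMod n p z - v ∈ S}).ncard := by
  -- Moving the centre to the nearest integer vector costs `√n / 2` in radius. A shift by an integer
  -- vector is then only a change of coset, so a supremum over real centres reduces to finitely many
  -- `v`.
  set x₀ := roundVec y with hx₀
  have hx₀' := norm_intVec_roundVec_sub_le y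
  rw [← hx₀] at hx₀'
  have htrans : ∀ σ : ℝ, (intPoints n 0 σ ∩ {z | reduceMod n p z - -reduceMod n p x₀ ∈ S}).ncard =
      (intPoints n (intVec n x₀) σ ∩ {z | reduceMod n p z ∈ S}).ncard := by
    intro σ
    rw [← Set.ncard_image_of_injective _ (add_left_injective x₀)]
    congr 1
    ext z
    constructor
    · rintro ⟨t, ⟨ht, htS⟩, rfl⟩
      refine ⟨?_, ?_⟩
      · change ‖_‖ ≤ _
        rw [map_add, add_sub_cancel_right]
        have : ‖intVec n t - 0‖ ≤ σ := ht
        rwa [sub_zero] at this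
      · change reduceMod n p (t + x₀) ∈ S
        rw [map_add]
        simpa using htS
    · rintro ⟨hz, hzS⟩
      refine ⟨z - x₀, ⟨?_, ?_⟩, sub_add_cancel z x₀⟩
      · change ‖_‖ ≤ _
        rw [map_sub, sub_zero]
        exact hz
      · change reduceMod n p (z - x₀) - _ ∈ S
        rw [map_sub, sub_neg_eq_add, sub_add_cancel]
        exact hzS
  refine ⟨-reduceMod n p x₀, ?_, ?_⟩
  · rw [htrans]
    refine Set.ncard_le_ncard ?_ ((intPoints_finite _ _ _).subset Set.inter_subset_left)
    rintro z ⟨hz, hzS⟩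
    refine ⟨?_, hzS⟩
    have h1 : ‖intVec n z - intVec n x₀‖ ≤ ρ - √n / 2 := hz
    change ‖intVec n z - y‖ ≤ ρ
    calc ‖intVec n z - y‖ = ‖(intVec n z - intVec n x₀) + (intVec n x₀ - y)‖ := by
          congr 1; abel
      _ ≤ _ := norm_add_le _ _
      _ ≤ _ := by linarith
  · rw [htrans]
    refine Set.ncard_le_ncard ?_ ((intPoints_finite _ _ _).subset Set.inter_subset_left)
    rintro z ⟨hz, hzS⟩
    refine ⟨?_, hzS⟩
    have h1 : ‖intVec n z - y‖ ≤ ρ := hz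
    change ‖intVec n z - intVec n x₀‖ ≤ ρ + √n / 2
    calc ‖intVec n z - intVec n x₀‖ = ‖(intVec n z - y) - (intVec n x₀ - y)‖ := by
          congr 1; abel
      _ ≤ _ := norm_sub_le _ _
      _ ≤ _ := by linarith

end LatticePointCount

/-! ### Numerical consequences of the choice of parameters. -/

section Parameters

/-- The real number under the ceiling is the exponent `x` with `p^x = (3√n)^n`, because `log (9n) =
2 log (3√n)`; rounding up costs at most a factor `p`. The lower bound limits crowding of residues
when the ball is wide, and the upper one keeps the radius large. Since `9n ≤ p`, `x ≤ n/2`, which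
leaves room for `3 + c ≤ n`. -/
theorem exists_dimension_bounds {n p r : ℕ} (hn : 25 < n) (hp : 1024 * (n : ℝ) ^ 2 ≤ p)
    (hr : (r : ℤ) = 3 + ⌈(n : ℝ) / Real.log p * (1 / 2 * Real.log (9 * n))⌉) :
    ∃ c : ℕ, r = 3 + c ∧ 3 + c ≤ n ∧ (3 * √(n : ℝ)) ^ n ≤ (p : ℝ) ^ c ∧
      (p : ℝ) ^ c ≤ p * (3 * √(n : ℝ)) ^ n := by
  have hn' : (26 : ℝ) ≤ n := by exact_mod_cast hn
  have hp1 : (1 : ℝ) < p := by nlinarith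
  have hp0 : (0 : ℝ) < p := by linarith
  have hL : 0 < Real.log p := Real.log_pos hp1
  have hs : 0 < √(n : ℝ) := Real.sqrt_pos.2 (by linarith)
  set x := (n : ℝ) / Real.log p * (1 / 2 * Real.log (9 * n)) with hx
  have hlog9 : 0 < Real.log (9 * n) := Real.log_pos (by linarith)
  have hlog : Real.log (9 * n) = 2 * Real.log (3 * √(n : ℝ)) := by
    have h1 : (9 * n : ℝ) = (3 * √(n : ℝ)) ^ 2 := by
      rw [mul_pow, Real.sq_sqrt (by linarith)]; norm_num
    rw [h1, Real.log_pow]; norm_num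
  have hx0 : 0 < x := by positivity
  have hxL : x * Real.log p = n * Real.log (3 * √(n : ℝ)) := by
    rw [hx, hlog]; field_simp
  have hceil : 0 < ⌈x⌉ := Int.ceil_pos.2 hx0
  obtain ⟨c, hc⟩ : ∃ c : ℕ, ⌈x⌉ = c := ⟨⌈x⌉.toNat, by omega⟩
  have hcr : (c : ℝ) = (⌈x⌉ : ℝ) := by rw [hc]; simp
  have hxc : x ≤ c := by rw [hcr]; exact Int.le_ceil x
  have hcx : (c : ℝ) < x + 1 := by rw [hcr]; exact Int.ceil_lt_add_one x
  have hpc : (p : ℝ) ^ c = Real.exp (c * Real.log p) := by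
    rw [Real.exp_nat_mul, Real.exp_log hp0]
  have hsn : (3 * √(n : ℝ)) ^ n = Real.exp (x * Real.log p) := by
    rw [hxL, Real.exp_nat_mul, Real.exp_log (by positivity)]
  refine ⟨c, by omega, ?_, ?_, ?_⟩
  · have h1 : Real.log (9 * n) ≤ Real.log p := Real.log_le_log (by linarith) (by nlinarith)
    have h2 : x ≤ n / 2 := by
      rw [hx, div_mul_eq_mul_div, div_le_iff₀ hL]
      nlinarith
    have h3 : (3 : ℝ) + c ≤ n := by linarith
    exact_mod_cast h3
  · rw [hpc, hsn]
    exact Real.exp_le_exp.2 (mul_le_mul_of_nonneg_right hxc hL.le)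
  · rw [hpc, hsn]
    nth_rewrite 2 [← Real.exp_log hp0]
    rw [← Real.exp_add]
    refine Real.exp_le_exp.2 ?_
    nlinarith

/-- A smaller `ρ` inserted in the volume identity gives `p^(n-1) ≤ (96 n² / ε)^n`, as `8 · 4 · 3 =
96`. But `p ≥ (1024 / ε) (n² / ε)`, so the left side wins by a factor exponential in `n`; a spare
power of `ε` absorbs the one unmatched `1 / ε`. -/
theorem radius_lower_bound {n c : ℕ} {p ε V ω ρ : ℝ} (hn : 25 < n) (hε : 0 < ε) (hε1 : ε ≤ 1)
    (hp : 1024 / ε ^ 2 * (n : ℝ) ^ 2 ≤ p) (hω0 : 0 < ω) (hω : ω ≤ 4 ^ n) (hV : p ^ 3 ≤ V)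
    (hρ : 0 < ρ) (hVρ : V * p ^ n = ρ ^ n * ω * p ^ (3 + c))
    (hc : p ^ c ≤ p * (3 * √(n : ℝ)) ^ n) : 8 * n * √(n : ℝ) ≤ ε * ρ := by
  by_contra hcon
  rw [not_le] at hcon
  have hn' : (26 : ℝ) ≤ n := by exact_mod_cast hn
  have hs0 : 0 < √(n : ℝ) := Real.sqrt_pos.2 (by linarith)
  have hs2 : √(n : ℝ) ^ 2 = n := Real.sq_sqrt (by linarith)
  have hp0 : 0 < p := lt_of_lt_of_le (by positivity) hp
  have hρT : ρ ≤ 8 * n * √(n : ℝ) / ε := by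
    rw [le_div_iff₀ hε]; linarith
  obtain ⟨k, rfl⟩ : ∃ k, n = k + 1 := ⟨n - 1, by omega⟩
  set N : ℝ := ((k + 1 : ℕ) : ℝ) with hN
  set b := N ^ 2 / ε with hb
  have hb0 : 0 < b := by positivity
  have h1 : p ^ 3 * p ^ (k + 1) ≤ (p ^ 3 * p) * (96 * b) ^ (k + 1) := by
    calc p ^ 3 * p ^ (k + 1) ≤ V * p ^ (k + 1) := by gcongr
      _ = ρ ^ (k + 1) * ω * (p ^ 3 * p ^ c) := by rw [hVρ, pow_add p 3 c]
      _ ≤ (8 * N * √N / ε) ^ (k + 1) * 4 ^ (k + 1) * (p ^ 3 * (p * (3 * √N) ^ (k + 1))) := by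
          gcongr
      _ = (p ^ 3 * p) * (8 * N * √N / ε * 4 * (3 * √N)) ^ (k + 1) := by
          generalize 8 * N * √N / ε = A
          generalize 3 * √N = D
          rw [mul_pow, mul_pow]; ring
      _ = (p ^ 3 * p) * (96 * b) ^ (k + 1) := by
          congr 2
          calc 8 * N * √N / ε * 4 * (3 * √N) = 96 * N * √N ^ 2 / ε := by ring
            _ = 96 * b := by rw [hs2, hb]; ring
  have h2 : p ^ k ≤ (96 * b) ^ (k + 1) := by
    have : (p ^ 3 * p) * p ^ k ≤ (p ^ 3 * p) * (96 * b) ^ (k + 1) := by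
      calc (p ^ 3 * p) * p ^ k = p ^ 3 * p ^ (k + 1) := by ring
        _ ≤ _ := h1
    exact le_of_mul_le_mul_left this (by positivity)
  have h3 : 1024 / ε * b ≤ p := by
    refine le_trans (le_of_eq ?_) hp
    rw [hb]; field_simp
  have h4 : (1024 / ε) ^ k * b ^ k ≤ (96 * b * 96 ^ k) * b ^ k := by
    calc (1024 / ε) ^ k * b ^ k = (1024 / ε * b) ^ k := by rw [mul_pow]
      _ ≤ p ^ k := by gcongr
      _ ≤ _ := h2
      _ = _ := by rw [pow_succ, mul_pow]; ring
  have h5 := le_of_mul_le_mul_right h4 (by positivity)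
  have hk : 25 ≤ k := by omega
  have h6 : ε ^ k ≤ ε := by
    calc ε ^ k ≤ ε ^ 1 := pow_le_pow_of_le_one hε.le hε1 (by omega)
      _ = ε := pow_one ε
  have h7 : (1024 : ℝ) ^ k / ε ≤ 96 * b * 96 ^ k := by
    refine le_trans ?_ h5
    rw [div_pow]
    gcongr
  have h8 : (1024 : ℝ) ^ k ≤ 96 * N ^ 2 * 96 ^ k := by
    rw [div_le_iff₀ hε] at h7
    calc _ ≤ _ := h7
      _ = _ := by rw [hb]; field_simp
  have h9 : (10 : ℝ) ^ k * 96 ^ k ≤ 1024 ^ k := by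
    rw [← mul_pow]; gcongr; norm_num
  have h10 : (10 : ℝ) ^ k ≤ 96 * N ^ 2 := by
    have : (10 : ℝ) ^ k * 96 ^ k ≤ 96 * N ^ 2 * 96 ^ k := h9.trans h8
    exact le_of_mul_le_mul_right this (by positivity)
  have h11 : N ≤ 2 * 2 ^ k := by
    have : k + 1 < 2 ^ (k + 1) := Nat.lt_two_pow_self
    have h12 : N ≤ (2 : ℝ) ^ (k + 1) := by rw [hN]; exact_mod_cast this.le
    rw [pow_succ] at h12; linarith
  have h12 : N ^ 2 ≤ 4 * 4 ^ k := by
    calc N ^ 2 ≤ (2 * 2 ^ k) ^ 2 := by gcongr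
      _ = 4 * (2 ^ 2) ^ k := by rw [← pow_mul]; ring
      _ = _ := by norm_num
  have h13 : (2 : ℝ) ^ 25 ≤ 2 ^ k := pow_le_pow_right₀ (by norm_num) hk
  have h14 : (2 : ℝ) ^ k * 4 ^ k ≤ 10 ^ k := by
    rw [← mul_pow]; gcongr; norm_num
  have h15 : (0 : ℝ) < 4 ^ k := by positivity
  nlinarith

theorem one_sub_le_one_sub_div_pow {n : ℕ} {t τ : ℝ} (hτ : n * t ≤ τ) (ht : t ≤ 1) :
    1 - τ ≤ (1 - t) ^ n := by
  have := one_add_mul_le_pow (a := -t) (by linarith) n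
  rw [← sub_eq_add_neg] at this
  linarith

theorem one_add_pow_le {n : ℕ} {t τ : ℝ} (ht : 0 ≤ t) (hτ : n * t ≤ τ) (hτ1 : τ ≤ 1 / 2) :
    (1 + t) ^ n ≤ 1 + 2 * τ := by
  have hτ0 : 0 ≤ τ := le_trans (by positivity) hτ
  calc (1 + t) ^ n ≤ Real.exp t ^ n := by
        gcongr
        linarith [Real.add_one_le_exp t]
    _ = Real.exp (n * t) := by rw [Real.exp_nat_mul]
    _ ≤ Real.exp τ := Real.exp_le_exp.2 hτ
    _ ≤ 1 / (1 - τ) := Real.exp_bound_div_one_sub_of_interval hτ0 (by linarith)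
    _ ≤ 1 + 2 * τ := by
        rw [div_le_iff₀ (by linarith)]
        nlinarith

end Parameters

/-! ### Equidistribution of the residues of a large ball. -/

section Residues

open Classical in
/-- The residues of the integer points of a large ball are equidistributed among the translates of
a random subspace. -/
theorem ncard_deviating_intPoints_le {n r p : ℕ} (hn : 25 < n) (hp : p.Prime) (hr : 2 ≤ r)
    (hrn : r ≤ n) {ρ ρ' ε κ : ℝ} (hρ' : |ρ' - ρ| ≤ √n / 2) (hρ : √(n : ℝ) < ρ)
    (hps : 8 * √(n : ℝ) + 1 ≤ p) (hr3 : (p : ℝ) ^ 3 * (3 * √(n : ℝ)) ^ n ≤ (p : ℝ) ^ r)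
    (hvol : (p : ℝ) ^ 3 ≤ (ρ - √n) ^ n * unitBallVolume n * (p : ℝ) ^ r / (p : ℝ) ^ n)
    (hε : 0 < ε) (hε1 : ε ≤ 1) (hκ : 4 * (n : ℝ) ^ 2 ≤ κ * p) (hq : 256 * (n : ℝ) ≤ ε ^ 2 * p) :
    ({S ∈ SmoothCover.grassmannian n r p | ∃ v,
      ε * ((intPoints n 0 ρ').ncard * (p : ℝ) ^ r / (p : ℝ) ^ n) ≤
        |((intPoints n 0 ρ' ∩ {z | reduceMod n p z - v ∈ S}).ncard : ℝ) -
          (intPoints n 0 ρ').ncard * (p : ℝ) ^ r / (p : ℝ) ^ n|}.ncard : ℝ) ≤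
      (SmoothCover.grassmannian n r p).ncard * (16 / (ε ^ 2 * p) + 4 * κ) := by
  have : Fact p.Prime := ⟨hp⟩
  have hp0 : (0 : ℝ) < p := by exact_mod_cast hp.pos
  have hn' : (26 : ℝ) ≤ n := by exact_mod_cast hn
  have hs0 : 0 < √(n : ℝ) := Real.sqrt_pos.2 (by linarith)
  have hs2 : √(n : ℝ) * √(n : ℝ) = n := Real.mul_self_sqrt (by linarith)
  have hs5 : 5 ≤ √(n : ℝ) := Real.le_sqrt_of_sq_le (by linarith)
  have hω := unitBallVolume_pos n
  obtain ⟨hρ1, hρ2⟩ := abs_le.1 hρ'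
  have hρ'0 : 0 ≤ ρ' := by linarith
  set s := √(n : ℝ) with hs
  set C : ℝ := ((intPoints n 0 ρ').ncard : ℝ) with hC
  set μ := C * (p : ℝ) ^ r / (p : ℝ) ^ n with hμ
  have hCl : (ρ - s) ^ n * unitBallVolume n ≤ C := by
    refine le_trans ?_ (le_ncard_intPoints 0 (by linarith))
    exact mul_le_mul_of_nonneg_right (pow_le_pow_left₀ (by linarith) (by linarith) n) hω.le
  have hμl : (ρ - s) ^ n * unitBallVolume n * (p : ℝ) ^ r / (p : ℝ) ^ n ≤ μ := by
    rw [hμ]; gcongr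
  have hμ3 : (p : ℝ) ^ 3 ≤ μ := hvol.trans hμl
  have hμ0 : 0 < μ := lt_of_lt_of_le (by positivity) hμ3
  have hsum : ∑ v, residueWeight n p ρ' v = C := by
    have h := sum_residueWeight_eq (n := n) (p := p) ρ' Finset.univ 0
    simpa using h
  -- A ball of diameter below `p` meets each residue class at most once, and `p³ ≤ μ` suffices. A
  -- wider ball may meet a class often, and then the factor `(3√n)^n` contained in `p^r`
  -- compensates.
  obtain ⟨W, hW, hWμ⟩ : ∃ W, (∀ v, residueWeight n p ρ' v ≤ W) ∧ W * (p : ℝ) ^ 3 ≤ μ := by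
    by_cases hsmall : 2 * ρ' < p
    · exact ⟨1, fun v => residueWeight_le_one hsmall v, by linarith⟩
    · rw [not_lt] at hsmall
      refine ⟨_, fun v => residueWeight_le hp.ne_zero hρ'0 v, le_trans ?_ hμl⟩
      -- Here `p ≤ 2ρ' ≤ 2ρ + s`, so `s p / 2` is about `s ρ`. The remaining terms fit into `3 s (ρ
      -- - s)` because `p ≥ 8s + 1` makes `ρ` a sufficiently large multiple of `s`.
      have h1 : ρ' / p + s / 2 ≤ (ρ - s) / p * (3 * s) := by
        rw [div_add' _ _ _ hp0.ne', div_mul_eq_mul_div (ρ - s)]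
        refine div_le_div_of_nonneg_right ?_ hp0.le
        have h2 : (p : ℝ) - s ≤ 2 * ρ := by linarith
        have h3 : 0 ≤ s * (2 * ρ - ((p : ℝ) - s)) := by
          apply mul_nonneg hs0.le; linarith
        have h4 : 0 ≤ s * ((p : ℝ) - (8 * s + 1)) := by
          apply mul_nonneg hs0.le; linarith
        have h5 : 0 ≤ (s - 5) * ρ := by
          apply mul_nonneg <;> linarith
        nlinarith
      have h2 : 0 ≤ (ρ - s) / p := div_nonneg (by linarith) hp0.le
      calc (ρ' / p + s / 2) ^ n * unitBallVolume n * (p : ℝ) ^ 3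
          ≤ ((ρ - s) / p * (3 * s)) ^ n * unitBallVolume n * (p : ℝ) ^ 3 := by gcongr
        _ = (ρ - s) ^ n * unitBallVolume n * ((p : ℝ) ^ 3 * (3 * s) ^ n) / (p : ℝ) ^ n := by
            rw [mul_pow, div_pow]; field_simp
        _ ≤ (ρ - s) ^ n * unitBallVolume n * (p : ℝ) ^ r / (p : ℝ) ^ n := by
            have : 0 ≤ ρ - s := by linarith
            gcongr
  have hmain := ncard_deviating_submodules_le hp hr hrn (residueWeight n p ρ') (W := W) (ε := ε)
    (κ := κ) (μ := μ) (fun v => residueWeight_nonneg _ _ _ _) hW hε hε1 hμ0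
    (by rw [hsum, hμ]; field_simp) hWμ hκ hq
  refine le_trans (le_of_eq ?_) hmain
  congr 2
  ext S
  refine and_congr_right fun _ => exists_congr fun v => ?_
  rw [sum_residueWeight_eq]
  simp only [Finset.mem_filter, Finset.mem_univ, true_and]

end Residues

/-! ### The ensemble as a probability measure. -/

section Ensemble

open MeasureTheory

instance measurableSingletonClass_subspace (n p : ℕ) :
    MeasurableSingletonClass (Submodule (ZMod p) (Fin n → ZMod p)) := ⟨fun _ => trivial⟩

theorem measurable_constructionA (n p : ℕ) :
    Measurable (SmoothCover.constructionA (n := n) p) := fun _ _ => trivial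

theorem grassmannian_nonempty {n r p : ℕ} (hp : p.Prime) (hr : r ≤ n) :
    (SmoothCover.grassmannian n r p).Nonempty := by
  have : Fact p.Prime := ⟨hp⟩
  obtain ⟨f, hf⟩ := exists_linearIndependent_of_le_finrank (R := ZMod p) (M := Fin n → ZMod p)
    (n := r) (by simpa using hr)
  exact ⟨Submodule.span (ZMod p) (Set.range f), by
    simpa [SmoothCover.grassmannian] using finrank_span_eq_card hf⟩

theorem grassmannian_finite {n r p : ℕ} (hp : p.Prime) :
    (SmoothCover.grassmannian n r p).Finite := by
  have : Fact p.Prime := ⟨hp⟩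
  exact Set.toFinite _

theorem uniformOn_lt_of_ncard {Ω : Type*} [MeasurableSpace Ω] [MeasurableSingletonClass Ω]
    {s A : Set Ω} (hs : s.Finite) (hs0 : s.Nonempty) {x δ : ℝ}
    (h : ((s ∩ A).ncard : ℝ) ≤ s.ncard * x) (hx : x < δ) :
    ProbabilityTheory.uniformOn s A < ENNReal.ofReal δ := by
  classical
  have hcount : ∀ t ⊆ s, Measure.count t = ENNReal.ofReal (t.ncard : ℝ) := by
    intro t ht
    rw [Measure.count_apply_finite t (hs.subset ht), ← Set.ncard_eq_toFinset_card t (hs.subset ht),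
      ENNReal.ofReal_natCast]
  have hpos : (0 : ℝ) < s.ncard := by
    exact_mod_cast (Set.ncard_pos hs).2 hs0
  rw [ProbabilityTheory.uniformOn, ProbabilityTheory.cond_apply hs.measurableSet,
    hcount s subset_rfl, hcount _ Set.inter_subset_left, ← ENNReal.ofReal_inv_of_pos hpos,
    ← ENNReal.ofReal_mul (by positivity)]
  have h1 : ((s.ncard : ℝ))⁻¹ * ((s ∩ A).ncard : ℝ) ≤ x := by
    rw [inv_mul_le_iff₀ hpos]; exact h
  have h2 : 0 ≤ ((s.ncard : ℝ))⁻¹ * ((s ∩ A).ncard : ℝ) := by positivity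
  exact (ENNReal.ofReal_lt_ofReal_iff (by linarith)).2 (by linarith)

theorem isProbabilityMeasure_constructionAEnsemble {n r p : ℕ} (hp : p.Prime) (hr : r ≤ n) :
    IsProbabilityMeasure (SmoothCover.constructionAEnsemble n p r) := by
  have := ProbabilityTheory.isProbabilityMeasure_uniformOn' (grassmannian_finite (n := n) (r := r) hp)
    (grassmannian_nonempty hp hr) trivial
  exact Measure.isProbabilityMeasure_map (measurable_constructionA n p).aemeasurable

end Ensemble

/-! ### From equidistributed cosets to covering smoothness, and conclusion. -/

/-- The `r`-dimensional subspaces some translate of which contains a proportion of the integer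
points of a ball that is off by a relative error of at least `ε`. -/
def deviatingSubmodules (n r p : ℕ) (ε ρ : ℝ) : Set (Submodule (ZMod p) (Fin n → ZMod p)) :=
  {S ∈ SmoothCover.grassmannian n r p | ∃ v,
    ε * ((intPoints n 0 ρ).ncard * (p : ℝ) ^ r / (p : ℝ) ^ n) ≤
      |((intPoints n 0 ρ ∩ {z | reduceMod n p z - v ∈ S}).ncard : ℝ) -
        (intPoints n 0 ρ).ncard * (p : ℝ) ^ r / (p : ℝ) ^ n|}

/-- Every translated count is squeezed between coset counts at the radii `ρ ± √n / 2`. Each bound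
combines a coset error `ε/4` with a volume error, and both `(1 - ε/4)(1 - ε/8)` and `(1 + ε/4)²`
stay within `5ε/8` of one. -/
theorem coveringSmoothness_le_of_notMem_deviatingSubmodules {n r p : ℕ} (hn : n ≠ 0)
    (hp : p.Prime) {α ε γ ρ V : ℝ} (hα : 0 < α) (hε0 : 0 < ε) (hε1 : ε < 1)
    (hγ : γ = (p : ℝ) ^ ((r : ℝ) / n)) (hρ : ρ = α * (p / γ)) (hρs : √(n : ℝ) < ρ)
    (hV : V = MeasureTheory.volume.real (α • Metric.closedBall (0 : SmoothCover.Euc n) 1))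
    (hV0 : 0 < V)
    (hlower : (1 - ε / 8) * V ≤ (ρ - √n) ^ n * unitBallVolume n * (p : ℝ) ^ r / (p : ℝ) ^ n)
    (hupper : (ρ + √n) ^ n * unitBallVolume n * (p : ℝ) ^ r / (p : ℝ) ^ n ≤ (1 + ε / 4) * V)
    {S : Submodule (ZMod p) (Fin n → ZMod p)} (hS : S ∈ SmoothCover.grassmannian n r p)
    (hS1 : S ∉ deviatingSubmodules n r p (ε / 4) (ρ - √n / 2))
    (hS2 : S ∉ deviatingSubmodules n r p (ε / 4) (ρ + √n / 2)) :
    SmoothCover.coveringSmoothness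
      (α • Metric.closedBall (0 : SmoothCover.Euc n) 1) (γ • SmoothCover.constructionA p S) ≤
      ENNReal.ofReal (5 * ε / 8) := by
  have hp0 : (0 : ℝ) < p := by exact_mod_cast hp.pos
  have hγ0 : 0 < γ := by rw [hγ]; positivity
  have hω0 : 0 < unitBallVolume n := unitBallVolume_pos n
  have hs0 : 0 ≤ √(n : ℝ) := Real.sqrt_nonneg _
  refine iSup_le fun x => ENNReal.ofReal_le_ofReal ?_
  have hcov : ZLattice.covolume (γ • SmoothCover.constructionA p S) = 1 := by
    rw [hγ]; exact covolume_scaled_constructionA (by omega) hp hS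
  rw [hcov, div_one, pointCount_scaled_constructionA hp.ne_zero hγ0 hα, ← hρ, ← hV]
  obtain ⟨v, hv1, hv2⟩ := ncard_intPoints_coset_mem_Icc ρ S ((p / γ) • x)
  set Nx : ℝ := ((intPoints n ((p / γ) • x) ρ ∩ {z | reduceMod n p z ∈ S}).ncard : ℝ) with hNx
  have hv1' : ((intPoints n 0 (ρ - √n / 2) ∩ {z | reduceMod n p z - v ∈ S}).ncard : ℝ) ≤ Nx := by
    exact Nat.cast_le.2 hv1
  have hv2' : Nx ≤ ((intPoints n 0 (ρ + √n / 2) ∩ {z | reduceMod n p z - v ∈ S}).ncard : ℝ) := by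
    exact Nat.cast_le.2 hv2
  have hdev : ∀ ρ' : ℝ, S ∉ deviatingSubmodules n r p (ε / 4) ρ' →
      |((intPoints n 0 ρ' ∩ {z | reduceMod n p z - v ∈ S}).ncard : ℝ) -
        (intPoints n 0 ρ').ncard * (p : ℝ) ^ r / (p : ℝ) ^ n| ≤
      ε / 4 * ((intPoints n 0 ρ').ncard * (p : ℝ) ^ r / (p : ℝ) ^ n) := by
    intro ρ' h
    by_contra h'
    exact h ⟨hS, v, (not_le.1 h').le⟩
  have hlo := (abs_le.1 (hdev _ hS1)).1
  have hhi := (abs_le.1 (hdev _ hS2)).2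
  have hμlo : (1 - ε / 8) * V ≤
      (intPoints n 0 (ρ - √n / 2)).ncard * (p : ℝ) ^ r / (p : ℝ) ^ n := by
    have h1 := le_ncard_intPoints (n := n) 0 (ρ := ρ - √n / 2) (by linarith)
    rw [show ρ - √(n : ℝ) / 2 - √n / 2 = ρ - √n by ring] at h1
    refine hlower.trans ?_
    gcongr
  have hμhi : (intPoints n 0 (ρ + √n / 2)).ncard * (p : ℝ) ^ r / (p : ℝ) ^ n ≤
      (1 + ε / 4) * V := by
    have h1 := ncard_intPoints_le (n := n) 0 (ρ := ρ + √n / 2) (by linarith)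
    rw [show ρ + √(n : ℝ) / 2 + √n / 2 = ρ + √n by ring] at h1
    refine le_trans ?_ hupper
    gcongr
  rw [abs_le]
  constructor
  · rw [le_sub_iff_add_le, le_div_iff₀ hV0]
    have h2 := mul_le_mul_of_nonneg_left hμlo (show 0 ≤ 1 - ε / 4 by linarith)
    have h3 : (-(5 * ε / 8) + 1) * V ≤ (1 - ε / 4) * ((1 - ε / 8) * V) := by
      rw [← mul_assoc]
      apply mul_le_mul_of_nonneg_right _ hV0.le
      nlinarith
    linarith
  · rw [sub_le_iff_le_add, div_le_iff₀ hV0]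
    have h2 := mul_le_mul_of_nonneg_left hμhi (show 0 ≤ 1 + ε / 4 by linarith)
    have h3 : (1 + ε / 4) * ((1 + ε / 4) * V) ≤ (5 * ε / 8 + 1) * V := by
      rw [← mul_assoc]
      apply mul_le_mul_of_nonneg_right _ hV0.le
      nlinarith
    linarith

/-- Being a probability measure encodes the existence of `r`-dimensional subspaces, as the uniform
law on an empty family is zero. Every subspace has positive mass, so the almost-everywhere statement
covers every lattice of the ensemble. -/
theorem corollary1p4 (n : ℕ) (hn : 25 < n) (δ ε : ℝ)
    (hδ : δ ∈ Set.Ioo (0 : ℝ) 1) (hε : ε ∈ Set.Ioo (0 : ℝ) 1)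
    (α : ℝ) (hα : 0 < α)
    (hvol : Real.exp 1 * 2 ^ 33 * (1 / (ε * δ)) ^ 6 * (n : ℝ) ^ 6 ≤
      MeasureTheory.volume.real (α • Metric.closedBall (0 : SmoothCover.Euc n) 1))
    (p : ℕ) (hp : p.Prime)
    (hp_lower : 1024 / (ε * δ) ^ 2 * (n : ℝ) ^ 2 ≤ p)
    (hp_upper : (p : ℝ) ≤ 2048 / (ε * δ) ^ 2 * (n : ℝ) ^ 2)
    (r : ℕ) (hr : (r : ℤ) = 3 + ⌈(n : ℝ) / Real.log p * (1 / 2 * Real.log (9 * n))⌉) :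
    MeasureTheory.IsProbabilityMeasure (SmoothCover.constructionAEnsemble n p r) ∧
    (∀ᵐ L ∂(SmoothCover.constructionAEnsemble n p r),
      ZLattice.covolume ((p : ℝ) ^ ((r : ℝ) / n) • L) = 1) ∧
    SmoothCover.constructionAEnsemble n p r
      {L | ENNReal.ofReal ε ≤ SmoothCover.coveringSmoothness
        (α • Metric.closedBall (0 : SmoothCover.Euc n) 1) ((p : ℝ) ^ ((r : ℝ) / n) • L)} <
      ENNReal.ofReal δ := by
  obtain ⟨hδ0, hδ1⟩ := hδ
  obtain ⟨hε0, hε1⟩ := hε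
  have hn' : (26 : ℝ) ≤ n := by exact_mod_cast hn
  have hnsq : 26 * (n : ℝ) ≤ n ^ 2 := by rw [sq]; gcongr
  have hp0 : (0 : ℝ) < p := by exact_mod_cast hp.pos
  have hε2 : ε ^ 2 ≤ 1 := pow_le_one₀ hε0.le hε1.le
  have hδ2 : δ ^ 2 ≤ 1 := pow_le_one₀ hδ0.le hδ1.le
  have hpεδ : 1024 * (n : ℝ) ^ 2 ≤ (ε * δ) ^ 2 * p := by
    rw [div_mul_eq_mul_div, div_le_iff₀ (by positivity)] at hp_lower
    linarith
  have hpε : 1024 * (n : ℝ) ^ 2 ≤ ε ^ 2 * p := by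
    refine hpεδ.trans (mul_le_mul_of_nonneg_right ?_ hp0.le)
    rw [mul_pow]
    exact mul_le_of_le_one_right (by positivity) hδ2
  have hp1024 : 1024 * (n : ℝ) ^ 2 ≤ p := hpε.trans (mul_le_of_le_one_left hp0.le hε2)
  obtain ⟨c, hrc, hcn, hc1, hc2⟩ := exists_dimension_bounds hn hp1024 hr
  subst hrc
  have hprob := isProbabilityMeasure_constructionAEnsemble (n := n) hp hcn
  have hn0 : (n : ℝ) ≠ 0 := by linarith
  refine ⟨hprob, ?_, ?_⟩
  · rw [SmoothCover.constructionAEnsemble,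
      MeasureTheory.ae_map_iff (measurable_constructionA n p).aemeasurable trivial]
    exact ProbabilityTheory.ae_cond_of_forall_mem
      (show MeasurableSet (SmoothCover.grassmannian n (3 + c) p) from trivial) fun S hS =>
      covolume_scaled_constructionA (by omega) hp hS
  set V := MeasureTheory.volume.real (α • Metric.closedBall (0 : SmoothCover.Euc n) 1) with hV
  set ω := unitBallVolume n with hω
  have hω0 : 0 < ω := unitBallVolume_pos n
  set γ : ℝ := (p : ℝ) ^ (((3 + c : ℕ) : ℝ) / n) with hγ
  have hγ0 : 0 < γ := by positivity
  have hγn : γ ^ n = (p : ℝ) ^ (3 + c) := by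
    rw [hγ, ← Real.rpow_natCast, ← Real.rpow_mul hp0.le, div_mul_cancel₀ _ hn0,
      Real.rpow_natCast]
  set ρ := α * (p / γ) with hρ
  have hρ0 : 0 < ρ := by positivity
  have hVω : V = α ^ n * ω := by
    rw [hV, smul_unitClosedBall_of_nonneg hα.le, volume_real_closedBall_eq _ hα.le]
  have hV0 : 0 < V := by rw [hVω]; positivity
  have hVρ : V * (p : ℝ) ^ n = ρ ^ n * ω * (p : ℝ) ^ (3 + c) := by
    rw [hVω, ← hγn, hρ, mul_pow, div_pow]; field_simp
  -- the volume dominates the cube of the modulus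
  have hV3 : Real.exp 1 * (p : ℝ) ^ 3 ≤ V := by
    refine le_trans ?_ hvol
    have h1 : (p : ℝ) ^ 3 ≤ (2048 / (ε * δ) ^ 2 * (n : ℝ) ^ 2) ^ 3 := by gcongr
    have h2 : (2048 / (ε * δ) ^ 2 * (n : ℝ) ^ 2) ^ 3 = 2 ^ 33 * (1 / (ε * δ)) ^ 6 * (n : ℝ) ^ 6 := by
      field_simp; norm_num
    rw [h2] at h1
    calc Real.exp 1 * (p : ℝ) ^ 3 ≤ Real.exp 1 * (2 ^ 33 * (1 / (ε * δ)) ^ 6 * (n : ℝ) ^ 6) := by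
          gcongr
      _ = _ := by ring
  -- Of the factor `e` only a factor two is needed: shrinking the radius keeps at least half of the
  -- volume, which must still be at least `p³`.
  have hexp : 2 ≤ Real.exp 1 := by linarith [Real.add_one_le_exp 1]
  have hp3 : 0 < (p : ℝ) ^ 3 := by positivity
  have hV2 : 2 * (p : ℝ) ^ 3 ≤ V := le_trans (by gcongr) hV3
  set s := √(n : ℝ) with hs
  have hs5 : 5 ≤ s := Real.le_sqrt_of_sq_le (by linarith)
  have hs2 : s * s = n := Real.mul_self_sqrt (by linarith)
  have hrad : 8 * n * s ≤ ε * ρ := by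
    refine radius_lower_bound hn hε0 hε1.le ?_ hω0 (unitBallVolume_le n) (by linarith) hρ0 hVρ hc2
    rw [div_mul_eq_mul_div, div_le_iff₀ (by positivity)]
    linarith
  -- The relative change of radius. With `n t ≤ ε/8`, the volume changes by at most `ε/8` downwards
  -- and `ε/4` upwards, relatively.
  set t := s / ρ with ht
  have ht0 : 0 ≤ t := by positivity
  have hnt : n * t ≤ ε / 8 := by
    rw [ht, ← mul_div_assoc, div_le_iff₀ hρ0]; linarith
  have ht1 : t ≤ 1 / 26 := by linarith [mul_le_mul_of_nonneg_right hn' ht0]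
  have hsρ : s < ρ := by
    have : s = t * ρ := by rw [ht]; field_simp
    linarith [mul_le_mul_of_nonneg_right ht1 hρ0.le]
  have hminus : (ρ - s) ^ n * ω * (p : ℝ) ^ (3 + c) / (p : ℝ) ^ n = (1 - t) ^ n * V := by
    have h1 : ρ - s = (1 - t) * ρ := by rw [ht]; field_simp
    rw [h1, mul_pow, div_eq_iff (by positivity), mul_assoc, mul_assoc, mul_assoc, hVρ]
    ring
  have hplus : (ρ + s) ^ n * ω * (p : ℝ) ^ (3 + c) / (p : ℝ) ^ n = (1 + t) ^ n * V := by
    have h1 : ρ + s = (1 + t) * ρ := by rw [ht]; field_simp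
    rw [h1, mul_pow, div_eq_iff (by positivity), mul_assoc, mul_assoc, mul_assoc, hVρ]
    ring
  have hminus' : 1 - ε / 8 ≤ (1 - t) ^ n := one_sub_le_one_sub_div_pow hnt (by linarith)
  have hplus' : (1 + t) ^ n ≤ 1 + 2 * (ε / 8) := one_add_pow_le ht0 hnt (by linarith)
  set bad := deviatingSubmodules n (3 + c) p (ε / 4) with hbad
  -- Error budget: each of the two radii contributes less than `δ/4` from the second moment and `4κ
  -- = δ/4` from the Kakeya bound.
  set κ := δ / 16 with hκ
  have hδε : ε ^ 2 * δ ^ 2 ≤ δ := (mul_le_of_le_one_left (sq_nonneg δ) hε2).trans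
    (pow_le_of_le_one hδ0.le hδ1.le two_ne_zero)
  have hbadcard : ∀ ρ' : ℝ, |ρ' - ρ| ≤ s / 2 → ((bad ρ').ncard : ℝ) ≤
      (SmoothCover.grassmannian n (3 + c) p).ncard * (16 / ((ε / 4) ^ 2 * p) + 4 * κ) := by
    intro ρ' hρ'
    refine ncard_deviating_intPoints_le hn hp (by omega) hcn hρ' hsρ ?_ ?_ ?_ (by linarith)
      (by linarith) ?_ ?_
    · linarith [mul_le_mul_of_nonneg_right hs5 (show 0 ≤ s by linarith)]
    · rw [pow_add]; gcongr
    · rw [hminus]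
      calc (p : ℝ) ^ 3 ≤ 1 / 2 * V := by linarith
        _ ≤ (1 - t) ^ n * V := by gcongr; linarith
    · rw [hκ]
      have : (ε * δ) ^ 2 * p ≤ δ * p := by
        rw [mul_pow]; gcongr
      linarith [sq_nonneg (n : ℝ)]
    · rw [div_pow]; linarith
  have hκδ : 2 * (16 / ((ε / 4) ^ 2 * p) + 4 * κ) < δ := by
    have h1 : 16 / ((ε / 4) ^ 2 * p) < δ / 4 := by
      rw [div_lt_iff₀ (by positivity)]
      have h2 : (ε * δ) ^ 2 * p ≤ δ * (ε ^ 2 * p) := by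
        have : (ε * δ) ^ 2 * p = δ * (δ * (ε ^ 2 * p)) := by ring
        rw [this]
        exact mul_le_of_le_one_left (by positivity) hδ1.le
      rw [div_pow]
      linarith [mul_self_nonneg (n : ℝ)]
    rw [hκ]; linarith
  -- outside the exceptional families the lattice is smooth
  have hgood : ∀ S ∈ SmoothCover.grassmannian n (3 + c) p, S ∉ bad (ρ - s / 2) →
      S ∉ bad (ρ + s / 2) → SmoothCover.coveringSmoothness
        (α • Metric.closedBall (0 : SmoothCover.Euc n) 1) (γ • SmoothCover.constructionA p S) ≤
        ENNReal.ofReal (5 * ε / 8) := fun S hS hS1 hS2 =>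
    coveringSmoothness_le_of_notMem_deviatingSubmodules (by omega) hp hα hε0 hε1 hγ hρ hsρ hV hV0
      (hminus.symm ▸ mul_le_mul_of_nonneg_right hminus' hV0.le)
      (hplus.symm ▸ mul_le_mul_of_nonneg_right (by linarith) hV0.le) hS hS1 hS2
  rw [SmoothCover.constructionAEnsemble,
    MeasureTheory.Measure.map_apply (measurable_constructionA n p) trivial]
  refine uniformOn_lt_of_ncard (grassmannian_finite hp) (grassmannian_nonempty hp hcn) ?_ hκδ
  have hsub : SmoothCover.grassmannian n (3 + c) p ∩ SmoothCover.constructionA p ⁻¹'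
      {L | ENNReal.ofReal ε ≤ SmoothCover.coveringSmoothness
        (α • Metric.closedBall (0 : SmoothCover.Euc n) 1) (γ • L)} ⊆
      bad (ρ - s / 2) ∪ bad (ρ + s / 2) := by
    rintro S ⟨hS, hSη⟩
    by_contra hnot
    rw [Set.mem_union, not_or] at hnot
    -- The margin `5ε/8 < ε` excludes even the boundary case, as the event is a non-strict
    -- inequality.
    have h1 := le_trans hSη (hgood S hS hnot.1 hnot.2)
    rw [ENNReal.ofReal_le_ofReal_iff (by positivity)] at h1
    linarith
  have hfin : (bad (ρ - s / 2) ∪ bad (ρ + s / 2)).Finite :=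
    (grassmannian_finite hp).subset (Set.union_subset (Set.sep_subset _ _) (Set.sep_subset _ _))
  have h1 := (Set.ncard_le_ncard hsub hfin).trans (Set.ncard_union_le _ _)
  have h2 : ((SmoothCover.grassmannian n (3 + c) p ∩ SmoothCover.constructionA p ⁻¹'
      {L | ENNReal.ofReal ε ≤ SmoothCover.coveringSmoothness
        (α • Metric.closedBall (0 : SmoothCover.Euc n) 1) (γ • L)}).ncard : ℝ) ≤
      (bad (ρ - s / 2)).ncard + (bad (ρ + s / 2)).ncard := by exact_mod_cast h1
  have h3 := hbadcard (ρ - s / 2) (by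
    rw [show ρ - s / 2 - ρ = -(s / 2) by ring, abs_neg, abs_of_nonneg (by linarith)])
  have h4 := hbadcard (ρ + s / 2) (by
    rw [show ρ + s / 2 - ρ = s / 2 by ring, abs_of_nonneg (by linarith)])
  linarith
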